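/- Let $n\ge 1$, let $W$ be a complex vector space with basis $w_1,\dots,w_{n+1}$, and for $1\le i\le n+1$ let $pr_i:W\to W$ be the linear map with $pr_i(w_i)=0$ and $pr_i(w_j)=w_j$ for $j\ne i$. Let the degenerate flag variety $\mathcal F^a_{n+1}$ be the closed subvariety of the product of Grassmannians $\prod_{k=1}^n \mathrm{Gr}_k(W)$ consisting of all collections $(V_1,\dots,V_n)$ of subspaces of $W$ with $\dim V_k=k$ and $$pr_{k+1}V_k\subset V_{k+1}\quad\text{for } k=1,\dots,n-1.$$ Let ${\bf S}=(S_1,\dots,S_n)$ be an admissible collection, i.e. a collection of subsets of $\{1,\dots,n+1\}$ with $\#S_k=k$ for $1\le k\le n$ and $S_k\subset S_{k+1}\cup\{k+1\}$ for $1\le k\le n-1$, and let $p_{\bf S}=(V_1,\dots,V_n)\in\mathcal F^a_{n+1}$ be the corresponding torus-fixed point, $V_k=\mathrm{span}(w_i:\ i\in S_k)$. Then $p_{\bf S}$ is a smooth point of $\mathcal F^a_{n+1}$ (that is, the local ring of the variety $\mathcal F^a_{n+1}$ at $p_{\bf S}$ is regular) if and only if for all $1\le j<i\le n$ the condition $i\in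 S_j$ implies $j+1\in S_i$. -/

import Mathlib

/-!
Conventions.  The ground field is `ℂ`.  The one-based indices `1, …, n` (for the subspaces `V_k` and
the sets `S_k`) and `1, …, n + 1` (for the basis vectors of `W`) are represented by `Fin n` and
`Fin (n + 1)`, so that everything is shifted by one: `k : Fin n` stands for `k + 1`.  Hence, for
`k : Fin n` standing for the number `m = k + 1`, the element `m` of `{1, …, n + 1}` is
`k.castSucc : Fin (n + 1)` and the element `m + 1` is `k.succ : Fin (n + 1)`.
-/

noncomputable section

namespace AffineSet

/-- The coordinate ring `ℂ[x_s : s ∈ σ] / I(X)` of a subset `X` of the affine space `ℂ^σ`. -/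
abbrev CoordinateRing {σ : Type} (X : Set (σ → ℂ)) : Type :=
  MvPolynomial σ ℂ ⧸ MvPolynomial.vanishingIdeal ℂ X

/-- Evaluation of regular functions at a point of `X`. -/
def evalAt {σ : Type} (X : Set (σ → ℂ)) (x : X) : CoordinateRing X →+* ℂ :=
  Ideal.Quotient.lift (MvPolynomial.vanishingIdeal ℂ X)
    (MvPolynomial.aeval (R := ℂ) (x : σ → ℂ)).toRingHom
    (fun _ hf => (MvPolynomial.mem_vanishingIdeal_iff.mp hf) x x.2)

instance evalAt_ker_isPrime {σ : Type} (X : Set (σ → ℂ)) (x : X) :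
    (RingHom.ker (evalAt X x)).IsPrime :=
  RingHom.ker_isPrime _

/-- The local ring of the affine algebraic set `X` at the point `x`: the localization of the
coordinate ring at the ideal of functions vanishing at `x`. -/
abbrev LocalRing {σ : Type} (X : Set (σ → ℂ)) (x : X) : Type :=
  Localization.AtPrime (RingHom.ker (evalAt X x))

/-- A point of an affine algebraic set is smooth if its local ring is a regular local ring. -/
def IsSmoothPoint {σ : Type} (X : Set (σ → ℂ)) (x : X) : Prop :=
  IsRegularLocalRing (LocalRing X x)

end AffineSet

namespace DegenerateFlag

/-- The `(n + 1)`-dimensional vector space `W`. -/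
abbrev W (n : ℕ) : Type := Fin (n + 1) → ℂ

/-- The standard basis vectors of `W`. -/
def w {n : ℕ} (i : Fin (n + 1)) : W n := Pi.single i 1

/-- The projection `pr_i : W → W` with `pr_i w_i = 0` and `pr_i w_j = w_j` for `j ≠ i`. -/
def pr {n : ℕ} (i : Fin (n + 1)) : W n →ₗ[ℂ] W n where
  toFun v := fun j => if j = i then 0 else v j
  map_add' u v := by
    funext j
    by_cases h : j = i <;> simp [h]
  map_smul' c v := by
    funext j
    by_cases h : j = i <;> simp [h]

/-- The product of Grassmannians `∏_{k=1}^n Gr_k(W)`, as a set of tuples of subspaces. -/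
def grassmannianProduct (n : ℕ) : Set (Fin n → Submodule ℂ (W n)) :=
  {V | ∀ k : Fin n, Module.finrank ℂ (V k) = (k : ℕ) + 1}

/-- The degenerate flag variety: the subvariety of `∏_{k=1}^n Gr_k(W)` of all `(V_k)` with
`pr_{k+1} V_k ⊆ V_{k+1}` for `k = 1, …, n - 1`. -/
def degenerateFlagVariety (n : ℕ) : Set (Fin n → Submodule ℂ (W n)) :=
  {V | V ∈ grassmannianProduct n ∧
    ∀ k l : Fin n, (k : ℕ) + 1 = (l : ℕ) → (V k).map (pr k.succ) ≤ V l}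

/-- A collection `J = (J_1, …, J_n)` of subsets of `{1, …, n + 1}` with `#J_k = k`. -/
def IsCollection {n : ℕ} (J : Fin n → Finset (Fin (n + 1))) : Prop :=
  ∀ k : Fin n, (J k).card = (k : ℕ) + 1

/-- Indices of the coordinates on the standard affine chart of `∏_k Gr_k(W)` attached to `J`:
the entries of an `(n + 1 - k) × k` matrix for every `k`. -/
abbrev ChartIndex {n : ℕ} (J : Fin n → Finset (Fin (n + 1))) : Type :=
  Σ k : Fin n, {a : Fin (n + 1) // a ∈ J k} × {b : Fin (n + 1) // b ∉ J k}

/-- The parametrization of the standard affine chart of `∏_k Gr_k(W)` attached to `J`.  The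
chart consists of all `(V_k)` for which `V_k` is a complement of `span(w_b, b ∉ J_k)`, that is, for
which `V_k` is the graph of a linear map `span(w_a, a ∈ J_k) → span(w_b, b ∉ J_k)`; the coordinates
are the matrix entries of these linear maps. -/
def chart {n : ℕ} (J : Fin n → Finset (Fin (n + 1))) (x : ChartIndex J → ℂ) :
    Fin n → Submodule ℂ (W n) :=
  fun k => Submodule.span ℂ (Set.range fun a : {a : Fin (n + 1) // a ∈ J k} =>
    w (a : Fin (n + 1)) + ∑ b : {b : Fin (n + 1) // b ∉ J k}, x ⟨k, a, b⟩ • w (b : Fin (n + 1)))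

/-- A point `p` of a closed subvariety `X` of `∏_k Gr_k(W)` is a smooth point of `X` if, in a
standard affine chart containing `p`, the local ring of `X` at `p` is regular. -/
def IsSmoothPoint {n : ℕ} (X : Set (Fin n → Submodule ℂ (W n)))
    (p : Fin n → Submodule ℂ (W n)) : Prop :=
  ∃ J : Fin n → Finset (Fin (n + 1)), IsCollection J ∧
    ∃ x : (chart J ⁻¹' X : Set (ChartIndex J → ℂ)),
      chart J x = p ∧ AffineSet.IsSmoothPoint (chart J ⁻¹' X) x

/-- Admissible collections: `#S_k = k` for all `k`, and `S_k ⊆ S_{k+1} ∪ {k + 1}` for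
`k = 1, …, n - 1`. -/
def IsAdmissible {n : ℕ} (S : Fin n → Finset (Fin (n + 1))) : Prop :=
  IsCollection S ∧ ∀ k l : Fin n, (k : ℕ) + 1 = (l : ℕ) → S k ⊆ S l ∪ {k.succ}

/-- The torus-fixed point `p_S = (V_1, …, V_n)`, `V_k = span(w_i, i ∈ S_k)`. -/
def fixedPoint {n : ℕ} (S : Fin n → Finset (Fin (n + 1))) : Fin n → Submodule ℂ (W n) :=
  fun k => Submodule.span ℂ (w '' (S k : Set (Fin (n + 1))))

end DegenerateFlag

end

/-!
Only the standard chart attached to `S` contains the point `p_S`, as its origin. In this chart the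
degenerate flag variety `X` is cut out by one equation for each `k < n`, `a ∈ S_k`, `c ∉ S_{k+1}`,
the `c`-th coordinate of the condition that the projection of the row `a` of the `k`-th matrix lies
in the next subspace. The number of coordinates exceeds the number of equations by
`D = n (n + 1) / 2` (`card_chartIndex`). The proof shows that `p_S` is smooth if and only if the gradients of these
equations at the origin are independent, and that this is the combinatorial condition.

*Independent gradients imply smoothness* (`AffineSet.isSmoothPoint_of_linearIndependent`). By
Nakayama's lemma the maximal ideal of the local ring has `D` generators, while Krull's height
theorem and the Nullstellensatz show that the local ring has dimension at least `D`.

*Dependent gradients imply singularity* (`AffineSet.not_isSmoothPoint_of_not_linearIndependent`).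
The common kernel of the gradients then has dimension greater than `D`. It consists of tangent
vectors of `X`, although the equations are not known to generate a radical ideal: the kernel is
stable under the torus, so that it is spanned by weight vectors, and on the line through a weight
vector in the kernel the equations vanish identically, their quadratic terms being products
`x_{ab} x_{bc}` of coordinates of different weights
(`gradAt_zero_dotProduct_eq_zero_of_forall_equationPoly`). Hence the maximal ideal needs more than
`D` generators, whereas the dimension is at most `D`.

*The dimension of `X` is at most `D`* (`ringKrullDim_coordinateRing_le`). A degenerate flag
`(U_1, …, U_n)` over any extension field of `ℂ` lifts to a triangular array of subspaces `V_{ij}`,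
`i ≤ j ≤ n`, with `dim V_{ij} = i` and `V_{jj} = U_j`, where `V_{ij}` lies in the span of the basis
vectors other than `w_{i+1}, …, w_j`, contains `V_{i-1,j}`, and is projected into `V_{i,j+1}` by the
projection along `w_{j+1}`. Given `V_{i-1,j}` and `V_{i,j+1}`, the space `V_{ij}` is a point of a
projective line, so that the array, and with it the flag, is defined over a field generated by `D`
elements (`exists_parameters_of_degenerateFlag`). For the generic points of `X` this bounds the
transcendence degrees of the function fields of its components.

*The combinatorial condition.* The gradient of the equation `(k, a, c)` at the origin involves only
the coordinates `x_{ac}` of the subspaces `k` and `k + 1`, the first one being absent if `c = k + 1`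
and the second one if `a = k + 1`. The equations of a fixed weight `(a, c)` with consecutive `k`
thus form chains, and a chain is dependent exactly if it lacks the first coordinate at its left end
and the last coordinate at its right end. This happens for `c = j + 1` at the left end and `a = i`
at the right end, i.e. exactly if `j < i`, `i ∈ S_j` and `j + 1 ∉ S_i`
(`not_linearIndependent_gradAt` and `linearIndependent_gradAt`).
-/

/-! ### Dimension of affine algebras -/

section

open MvPolynomial

theorem ringKrullDim_le_of_isIntegral (R S : Type*) [CommRing R] [CommRing S] [Algebra R S]
    [Algebra.IsIntegral R S] : ringKrullDim S ≤ ringKrullDim R :=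
  Order.krullDim_le_of_strictMono (PrimeSpectrum.comap (algebraMap R S)) fun _ _ h =>
    Ideal.IsIntegral.comap_lt_comap h

/-- By Noether normalization, `B` is integral over a polynomial ring whose number of variables is at
most the transcendence degree. -/
theorem ringKrullDim_le_of_trdeg_le (k B : Type*) [Field k] [CommRing B] [IsDomain B]
    [Algebra k B] [Algebra.FiniteType k B] (n : ℕ) (h : Algebra.trdeg k B ≤ n) :
    ringKrullDim B ≤ n := by
  obtain ⟨s, g, hg, hint⟩ := exists_integral_inj_algHom_of_fg k B
  have hs : s ≤ n := by
    have h1 := lift_trdeg_le_of_injective g hg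
    simp only [MvPolynomial.trdeg_of_isDomain] at h1
    have h2 := h1.trans (Cardinal.lift_le.mpr h)
    simpa using h2
  algebraize [g.toRingHom]
  have : Algebra.IsIntegral (MvPolynomial (Fin s) k) B := ⟨hint⟩
  refine (ringKrullDim_le_of_isIntegral (MvPolynomial (Fin s) k) B).trans ?_
  rw [MvPolynomial.ringKrullDim_of_isNoetherianRing]
  simpa using hs

/-- A chain of primes lives in the quotient by its first member. -/
theorem ringKrullDim_le_of_forall_quotient_prime (R : Type*) [CommRing R] (n : WithBot ℕ∞)
    (h : ∀ P : Ideal R, P.IsPrime → ringKrullDim (R ⧸ P) ≤ n) : ringKrullDim R ≤ n := by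
  refine iSup_le fun l => ?_
  refine le_trans ?_ (h l.head.asIdeal l.head.isPrime)
  rw [ringKrullDim_quotient]
  let l' : LTSeries (PrimeSpectrum.zeroLocus (R := R) (l.head.asIdeal : Set R)) :=
    { length := l.length
      toFun := fun i => ⟨l i, by
        have : l.head ≤ l i := l.monotone (Fin.zero_le i)
        exact this⟩
      step := fun i => l.step i }
  exact Order.LTSeries.length_le_krullDim l'

/-- A dimension bound by counting parameters at all generic points: it suffices that every
point of the zero locus of `I` over every extension field is rational over a field generated by at
most `n` elements. -/
theorem ringKrullDim_quotient_le_of_forall_point {σ k : Type} [Finite σ] [Field k]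
    (I : Ideal (MvPolynomial σ k)) (n : ℕ)
    (h : ∀ (K : Type) [Field K] [Algebra k K] (x : σ → K), (∀ f ∈ I, aeval x f = 0) →
      ∃ T : Finset K, T.card ≤ n ∧ ∀ s, x s ∈ IntermediateField.adjoin k (T : Set K)) :
    ringKrullDim (MvPolynomial σ k ⧸ I) ≤ n := by
  refine ringKrullDim_le_of_forall_quotient_prime _ _ fun P hP => ?_
  refine ringKrullDim_le_of_trdeg_le k _ n ?_
  -- The generic point of the component defined by `P` has coordinates in the fraction field `K`.
  let B := (MvPolynomial σ k ⧸ I) ⧸ P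
  let K := FractionRing B
  let φ : MvPolynomial σ k →ₐ[k] B :=
    (Ideal.Quotient.mkₐ k P).comp (Ideal.Quotient.mkₐ k I)
  have hφ : Function.Surjective φ :=
    (Ideal.Quotient.mkₐ_surjective k P).comp (Ideal.Quotient.mkₐ_surjective k I)
  let ψ : MvPolynomial σ k →ₐ[k] K := (IsScalarTower.toAlgHom k B K).comp φ
  have hψ : ψ = aeval (fun s => ψ (X s)) := by ext; simp
  obtain ⟨T, hT, hx⟩ := h K (fun s => ψ (X s)) (by
    intro f hf
    rw [← hψ]
    have : Ideal.Quotient.mk I f = 0 := Ideal.Quotient.eq_zero_iff_mem.mpr hf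
    simp [ψ, φ, this])
  have hB : ∀ b : B, algebraMap B K b ∈ IntermediateField.adjoin k (T : Set K) := by
    intro b
    obtain ⟨f, rfl⟩ := hφ b
    have h1 : algebraMap B K (φ f) = ψ f := rfl
    rw [h1]
    induction f using MvPolynomial.induction_on with
    | C a => exact (ψ.commutes a).symm ▸ IntermediateField.algebraMap_mem _ a
    | add p q hp hq => rw [map_add]; exact add_mem (hp rfl) (hq rfl)
    | mul_X p i hp => rw [map_mul]; exact mul_mem (hp rfl) (hx i)
  have hK : ∀ z : K, z ∈ IntermediateField.adjoin k (T : Set K) := by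
    intro z
    obtain ⟨a, b, rfl⟩ := IsLocalization.exists_mk'_eq (nonZeroDivisors B) z
    rw [IsFractionRing.mk'_eq_div]
    exact div_mem (hB _) (hB _)
  have : Algebra.IsAlgebraic (Algebra.adjoin k (T : Set K)) K := by
    refine ⟨fun z => ?_⟩
    obtain ⟨a, ha, b, hb, rfl⟩ := (IntermediateField.mem_adjoin_iff_div).mp (hK z)
    rw [div_eq_mul_inv]
    exact (isAlgebraic_algebraMap (⟨a, ha⟩ : Algebra.adjoin k (T : Set K))).mul
      (isAlgebraic_algebraMap (⟨b, hb⟩ : Algebra.adjoin k (T : Set K))).inv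
  have h1 : Algebra.trdeg k K ≤ Cardinal.mk (T : Set K) :=
    Algebra.IsAlgebraic.trdeg_le_cardinalMk k (T : Set K)
  have h2 : Algebra.trdeg k B ≤ Algebra.trdeg k K :=
    trdeg_le_of_injective (IsScalarTower.toAlgHom k B K) (IsFractionRing.injective B K)
  refine h2.trans (h1.trans ?_)
  exact (Cardinal.mk_coe_finset (s := T)).le.trans (by exact_mod_cast hT)

/-- The automorphism of the polynomial ring induced by translation by `y` permutes the maximal
ideals of points accordingly. -/
theorem MvPolynomial.vanishingIdeal_singleton_eq_comap_translate {σ k : Type*} [Field k]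
    (y : σ → k) :
    ∃ e : MvPolynomial σ k ≃+* MvPolynomial σ k, ∀ x : σ → k,
      (vanishingIdeal k {x}).comap e = vanishingIdeal k {x + y} := by
  let τ : (σ → k) → (MvPolynomial σ k →ₐ[k] MvPolynomial σ k) := fun y =>
    aeval fun s => X s + C (y s)
  refine ⟨(AlgEquiv.ofAlgHom (τ y) (τ (-y)) ?_ ?_).toRingEquiv, fun x => ?_⟩
  · ext s; simp [τ, MvPolynomial.algebraMap_eq]
  · ext s; simp [τ, MvPolynomial.algebraMap_eq]
  · ext f
    have : aeval x (τ y f) = aeval (x + y) f := by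
      have h : (aeval x : MvPolynomial σ k →ₐ[k] k).comp (τ y) = aeval (x + y) := by
        ext s; simp [τ]
      exact DFunLike.congr_fun h f
    rw [Ideal.mem_comap, mem_vanishingIdeal_singleton_iff, mem_vanishingIdeal_singleton_iff,
      ← this]
    rfl

/-- Some maximal ideal has height the dimension `#σ`; by the Nullstellensatz it belongs to a point,
and translations carry it to the ideal of any other point. -/
theorem MvPolynomial.height_vanishingIdeal_singleton {σ k : Type*} [Finite σ] [Field k]
    [IsAlgClosed k] (x : σ → k) :
    (vanishingIdeal k {x} : Ideal (MvPolynomial σ k)).height = Nat.card σ := by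
  have hdim : ringKrullDim (MvPolynomial σ k) = Nat.card σ := by
    rw [MvPolynomial.ringKrullDim_of_isNoetherianRing]; simp
  have : FiniteRingKrullDim (MvPolynomial σ k) := by
    rw [finiteRingKrullDim_iff_ne_bot_and_top, hdim]
    exact ⟨WithBot.natCast_ne_bot _, fun h =>
      ENat.natCast_ne_top (Nat.card σ) (WithBot.coe_injective h)⟩
  obtain ⟨p, hp, hht⟩ := Ideal.exists_isMaximal_height (R := MvPolynomial σ k)
  obtain ⟨y, rfl⟩ := (isMaximal_iff_eq_vanishingIdeal_singleton (K := k)).mp hp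
  obtain ⟨e, he⟩ := MvPolynomial.vanishingIdeal_singleton_eq_comap_translate (y - x)
  have h1 := e.height_comap (vanishingIdeal k {x})
  rw [he, add_sub_cancel] at h1
  rw [← h1]
  rw [hdim] at hht
  exact_mod_cast hht

end

/-! ### Gradients and the local ring of an affine algebraic set -/

noncomputable section

open MvPolynomial

namespace AffineSet

section Gradient

variable {σ : Type}

/-- The gradient of the polynomial `f` at the point `x`. -/
def gradAt (x : σ → ℂ) (f : MvPolynomial σ ℂ) : σ → ℂ := fun s => eval x (pderiv s f)

theorem gradAt_add (x : σ → ℂ) (f g : MvPolynomial σ ℂ) :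
    gradAt x (f + g) = gradAt x f + gradAt x g := by
  ext s; simp [gradAt]

theorem gradAt_sub (x : σ → ℂ) (f g : MvPolynomial σ ℂ) :
    gradAt x (f - g) = gradAt x f - gradAt x g := by
  ext s; simp [gradAt]

theorem gradAt_mul (x : σ → ℂ) (f g : MvPolynomial σ ℂ) :
    gradAt x (f * g) = eval x f • gradAt x g + eval x g • gradAt x f := by
  ext s; simp [gradAt, Derivation.leibniz]

theorem gradAt_C (x : σ → ℂ) (a : ℂ) : gradAt x (C a) = 0 := by
  ext s; simp [gradAt]

theorem gradAt_X [DecidableEq σ] (x : σ → ℂ) (s : σ) : gradAt x (X s) = Pi.single s 1 := by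
  ext t
  by_cases h : s = t
  · subst h; simp [gradAt]
  · simp [gradAt, pderiv_X_of_ne h, Ne.symm h]

theorem gradAt_sum {ι : Type*} (x : σ → ℂ) (t : Finset ι) (f : ι → MvPolynomial σ ℂ) :
    gradAt x (∑ i ∈ t, f i) = ∑ i ∈ t, gradAt x (f i) := by
  ext s; simp [gradAt, map_sum]

/-- The linear form with coefficients `c`, centred at the point `x`. -/
def linearForm [Fintype σ] (x : σ → ℂ) : (σ → ℂ) →ₗ[ℂ] MvPolynomial σ ℂ :=
  Fintype.linearCombination ℂ fun s => X s - C (x s)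

theorem linearForm_single [Fintype σ] [DecidableEq σ] (x : σ → ℂ) (s : σ) :
    linearForm x (Pi.single s 1) = X s - C (x s) := by
  simp [linearForm]

theorem linearForm_mem [Fintype σ] (x : σ → ℂ) (c : σ → ℂ) :
    linearForm x c ∈ vanishingIdeal ℂ {x} := by
  rw [mem_vanishingIdeal_singleton_iff]
  simp [linearForm, Fintype.linearCombination_apply]

/-- Taylor expansion to first order. -/
theorem sub_linearForm_gradAt_mem_sq [Fintype σ] (x : σ → ℂ) (f : MvPolynomial σ ℂ) :
    f - C (eval x f) - linearForm x (gradAt x f) ∈ (vanishingIdeal ℂ {x}) ^ 2 := by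
  classical
  induction f using MvPolynomial.induction_on with
  | C a => simp [gradAt_C]
  | add p q hp hq =>
    have := add_mem hp hq
    rw [gradAt_add, map_add, map_add, map_add]
    convert this using 1
    ring
  | mul_X p s hp =>
    have h1 : p - C (eval x p) ∈ vanishingIdeal ℂ {x} := by
      rw [mem_vanishingIdeal_singleton_iff]; simp
    have h2 : X s - C (x s) ∈ vanishingIdeal ℂ {x} := by
      rw [mem_vanishingIdeal_singleton_iff]; simp
    have h3 : (p - C (eval x p)) * (X s - C (x s)) ∈ (vanishingIdeal ℂ {x}) ^ 2 := by
      rw [sq]; exact Ideal.mul_mem_mul h1 h2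
    have h4 := Ideal.mul_mem_left _ (C (x s)) hp
    rw [gradAt_mul, gradAt_X, map_add, map_smul, map_smul, linearForm_single, eval_X,
      MvPolynomial.smul_eq_C_mul, MvPolynomial.smul_eq_C_mul]
    convert add_mem h3 h4 using 1
    simp only [map_mul, eval_X]
    ring

end Gradient

section LocalRing

/-! In this section `B`, with the quotient map `mk`, stands for the coordinate ring of `X`, the
prime `p` of `B` for the ideal of the point `x`, and `R` for the local ring of `X` at `x`. -/

variable {σ : Type} {X : Set (σ → ℂ)} {x : σ → ℂ} {B R : Type} [CommRing B] [CommRing R]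
  [Algebra B R] (p : Ideal B) [p.IsPrime] [IsLocalization.AtPrime R p]
  (mk : MvPolynomial σ ℂ →+* B)

theorem isUnit_germ (hp : p.comap mk = vanishingIdeal ℂ {x}) {t : MvPolynomial σ ℂ}
    (ht : eval x t ≠ 0) : IsUnit (algebraMap B R (mk t)) := by
  refine IsLocalization.map_units R (⟨mk t, fun h0 => ht ?_⟩ : p.primeCompl)
  have h1 : t ∈ p.comap mk := h0
  rwa [hp, mem_vanishingIdeal_singleton_iff, MvPolynomial.aeval_eq_eval] at h1

theorem maximalIdeal_eq_map_germ [IsLocalRing R] (hmk : Function.Surjective mk)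
    (hp : p.comap mk = vanishingIdeal ℂ {x}) :
    IsLocalRing.maximalIdeal R = (vanishingIdeal ℂ {x}).map ((algebraMap B R).comp mk) := by
  rw [← Ideal.map_map, ← hp, Ideal.map_comap_of_surjective _ hmk,
    IsLocalization.AtPrime.map_eq_maximalIdeal p R]

/-- If `#E` functions vanishing on `X` have independent gradients at `x`, then the maximal ideal of
the local ring is generated by `#σ - #E` elements: by Nakayama's lemma, it suffices to take the
germs of linear forms whose coefficient vectors span a complement of the gradients. -/
theorem spanFinrank_maximalIdeal_le [IsLocalRing R] [IsNoetherianRing R]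
    (hmk : Function.Surjective mk) (hker : RingHom.ker mk = vanishingIdeal ℂ X)
    (hp : p.comap mk = vanishingIdeal ℂ {x}) (hx : x ∈ X) [Finite σ] {E : Type} [Finite E]
    (f : E → MvPolynomial σ ℂ) (hf : ∀ e, f e ∈ vanishingIdeal ℂ X)
    (hli : LinearIndependent ℂ fun e => gradAt x (f e)) :
    (IsLocalRing.maximalIdeal R).spanFinrank + Nat.card E ≤ Nat.card σ := by
  classical
  let germ : MvPolynomial σ ℂ →+* R := (algebraMap B R).comp mk
  have hm := maximalIdeal_eq_map_germ (R := R) p mk hmk hp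
  have hgerm : ∀ g ∈ vanishingIdeal ℂ X, germ g = 0 := fun g hg => by
    rw [← hker, RingHom.mem_ker] at hg
    simp [germ, hg]
  have := Fintype.ofFinite σ
  have := Fintype.ofFinite E
  obtain ⟨U, hU⟩ := (Submodule.span ℂ (Set.range fun e => gradAt x (f e))).exists_isCompl
  have hfr := Submodule.finrank_add_eq_of_isCompl hU
  rw [finrank_span_eq_card hli, Module.finrank_fintype_fun_eq_card] at hfr
  let u := Module.finBasis ℂ U
  let m := IsLocalRing.maximalIdeal R
  let G : Ideal R :=
    Ideal.span (Set.range fun i => germ (linearForm x (u i : σ → ℂ)))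
  have hgm : ∀ g ∈ vanishingIdeal ℂ {x}, germ g ∈ m := fun g hg => by
    rw [show m = _ from maximalIdeal_eq_map_germ (R := R) p mk hmk hp]
    exact Ideal.mem_map_of_mem _ hg
  have hgm2 : ∀ g ∈ (vanishingIdeal ℂ {x}) ^ 2, germ g ∈ m ^ 2 := fun g hg => by
    rw [show m = _ from hm, ← Ideal.map_pow]
    exact Ideal.mem_map_of_mem _ hg
  -- The coefficient vectors whose linear form lies in `G + m²`.
  let Q : Submodule ℂ (σ → ℂ) :=
    (((G ⊔ m ^ 2).comap germ).restrictScalars ℂ).comap (linearForm x)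
  have hQ : Q = ⊤ := by
    rw [eq_top_iff, ← hU.sup_eq_top]
    refine sup_le (Submodule.span_le.mpr ?_) ?_
    · rintro _ ⟨e, rfl⟩
      change germ (linearForm x (gradAt x (f e))) ∈ G ⊔ m ^ 2
      have h1 := hgm2 _ (sub_linearForm_gradAt_mem_sq x (f e))
      have h2 : eval x (f e) = 0 := by
        rw [← MvPolynomial.aeval_eq_eval]; exact hf e x hx
      rw [map_sub, h2, map_zero, sub_zero, hgerm _ (hf e), zero_sub] at h1
      exact Ideal.mem_sup_right (neg_mem_iff.mp h1)
    · have h1 : U = Submodule.span ℂ (Set.range fun i => (u i : σ → ℂ)) := by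
        have := congrArg (Submodule.map U.subtype) u.span_eq
        rw [Submodule.map_span, Submodule.map_top, Submodule.range_subtype, ← Set.range_comp]
          at this
        exact this.symm
      rw [h1, Submodule.span_le]
      rintro _ ⟨i, rfl⟩
      exact Ideal.mem_sup_left (Ideal.subset_span ⟨i, rfl⟩)
  have hle : m ≤ G ⊔ m • m := by
    rw [smul_eq_mul, ← sq]
    conv_lhs => rw [show m = _ from hm]
    rw [Ideal.map_le_iff_le_comap]
    intro g hg
    rw [Ideal.mem_comap]
    have h1 := hgm2 _ (sub_linearForm_gradAt_mem_sq x g)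
    have h2 : eval x g = 0 := by
      rw [← MvPolynomial.aeval_eq_eval]; exact hg _ rfl
    have h3 : gradAt x g ∈ Q := hQ ▸ Submodule.mem_top
    change germ (linearForm x (gradAt x g)) ∈ G ⊔ m ^ 2 at h3
    rw [h2, map_zero, sub_zero, map_sub] at h1
    have := add_mem (Ideal.mem_sup_right h1 : _ ∈ G ⊔ m ^ 2) h3
    rwa [sub_add_cancel] at this
  have hmG : m ≤ G := Submodule.le_of_le_smul_of_le_jacobson_bot
    (IsNoetherian.noetherian m) (IsLocalRing.maximalIdeal_le_jacobson _) hle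
  have hGm : G ≤ m := by
    refine Ideal.span_le.mpr ?_
    rintro _ ⟨i, rfl⟩
    exact hgm _ (linearForm_mem _ _)
  have hmG : m = G := le_antisymm hmG hGm
  have h1 : m.spanFinrank ≤ Module.finrank ℂ U := by
    rw [hmG]
    refine (Submodule.spanFinrank_span_le_ncard_of_finite (Set.finite_range _)).trans ?_
    rw [← Set.image_univ]
    refine (Set.ncard_image_le Set.finite_univ).trans ?_
    simp
  rw [Nat.card_eq_fintype_card, Nat.card_eq_fintype_card]
  change m.spanFinrank + _ ≤ _
  omega

/-- A space of tangent vectors, i.e. of vectors orthogonal to the gradients of all functions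
vanishing on `X`, has dimension at most the minimal number of generators of the maximal ideal:
otherwise some nonzero tangent vector would be orthogonal to the gradients of all generators, hence
to the gradients of all functions vanishing at `x`, among them the coordinates. -/
theorem finrank_le_spanFinrank_maximalIdeal [IsLocalRing R] [IsNoetherianRing R]
    (hmk : Function.Surjective mk) (hker : RingHom.ker mk = vanishingIdeal ℂ X)
    (hp : p.comap mk = vanishingIdeal ℂ {x}) (hx : x ∈ X) [Fintype σ] (T : Submodule ℂ (σ → ℂ))
    (hT : ∀ v ∈ T, ∀ f ∈ vanishingIdeal ℂ X, gradAt x f ⬝ᵥ v = 0) :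
    Module.finrank ℂ T ≤ (IsLocalRing.maximalIdeal R).spanFinrank := by
  classical
  let germ : MvPolynomial σ ℂ →+* R := (algebraMap B R).comp mk
  by_contra! hlt
  let m := IsLocalRing.maximalIdeal R
  have hfg : m.FG := IsNoetherian.noetherian m
  have hfin : m.generators.Finite := Submodule.FG.finite_generators hfg
  have := hfin.fintype
  -- Every generator is, up to a unit, the germ of a polynomial.
  have hlift : ∀ r : m.generators, ∃ h t : MvPolynomial σ ℂ, eval x t ≠ 0 ∧
      (r : R) * germ t = germ h := by
    intro r
    obtain ⟨⟨b, t⟩, hbt⟩ := IsLocalization.surj p.primeCompl (r : R)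
    obtain ⟨h, hh⟩ := hmk b
    obtain ⟨t', ht'⟩ := hmk (t : B)
    refine ⟨h, t', fun h0 => t.2 ?_, ?_⟩
    · have h1 : t' ∈ p.comap mk := by
        rw [hp, mem_vanishingIdeal_singleton_iff, MvPolynomial.aeval_eq_eval]; exact h0
      rw [← ht']; exact h1
    · simpa [germ, hh, ht'] using hbt
  choose h t ht hht using hlift
  have hunit : ∀ t : MvPolynomial σ ℂ, eval x t ≠ 0 → IsUnit (germ t) :=
    fun t ht => isUnit_germ p mk hp ht
  have hgen : ∀ r : m.generators, (r : R) ∈ m := fun r => by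
    exact m.span_generators.le (Submodule.subset_span r.2)
  have hh0 : ∀ r, eval x (h r) = 0 := by
    intro r
    by_contra hne
    have h1 := hunit _ hne
    rw [← hht] at h1
    exact (IsLocalRing.mem_maximalIdeal _).mp (hgen r) (isUnit_of_mul_isUnit_left h1)
  let Φ : T →ₗ[ℂ] (m.generators → ℂ) :=
    LinearMap.pi fun r => (dotProductBilin ℂ ℂ (gradAt x (h r))).comp T.subtype
  have hΦ : LinearMap.ker Φ ≠ ⊥ := by
    refine LinearMap.ker_ne_bot_of_finrank_lt ?_
    rw [Module.finrank_fintype_fun_eq_card, ← Nat.card_eq_fintype_card, Nat.card_coe_set_eq,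
      Submodule.FG.generators_ncard hfg]
    exact hlt
  obtain ⟨⟨v, hvT⟩, hv, hv0⟩ := (Submodule.ne_bot_iff _).mp hΦ
  have hv : ∀ r, gradAt x (h r) ⬝ᵥ v = 0 := fun r => congrFun hv r
  -- The functions vanishing to first order at `x` in the direction `v`.
  let J : Ideal (MvPolynomial σ ℂ) :=
    { carrier := {f | eval x f = 0 ∧ gradAt x f ⬝ᵥ v = 0}
      zero_mem' := by simp [gradAt, dotProduct]
      add_mem' := by
        rintro f g ⟨h1, h2⟩ ⟨h3, h4⟩
        exact ⟨by simp [h1, h3], by rw [gradAt_add, add_dotProduct, h2, h4, add_zero]⟩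
      smul_mem' := by
        rintro g f ⟨h1, h2⟩
        refine ⟨by simp [h1], ?_⟩
        rw [smul_eq_mul, gradAt_mul, add_dotProduct, smul_dotProduct, smul_dotProduct, h1, h2]
        simp }
  have hm : m ≤ J.map germ := by
    rw [← m.span_generators, Submodule.span_le]
    intro r hr
    have h1 : germ (h ⟨r, hr⟩) ∈ J.map germ :=
      Ideal.mem_map_of_mem _ ⟨hh0 _, hv _⟩
    rw [← hht] at h1
    exact (Ideal.mul_unit_mem_iff_mem _ (hunit _ (ht ⟨r, hr⟩))).mp h1
  have hJ : ∀ f, germ f ∈ J.map germ → f ∈ J := by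
    intro f hf
    rw [← Ideal.map_map,
      IsLocalization.mem_map_algebraMap_iff p.primeCompl] at hf
    obtain ⟨⟨⟨b, hb⟩, c⟩, hbc⟩ := hf
    obtain ⟨g, hg, rfl⟩ := (Ideal.mem_map_iff_of_surjective _ hmk).mp hb
    simp only [germ, RingHom.comp_apply, ← map_mul] at hbc
    obtain ⟨d, hd⟩ := (IsLocalization.eq_iff_exists p.primeCompl R).mp hbc
    obtain ⟨c', hc'⟩ := hmk (c : B)
    obtain ⟨d', hd'⟩ := hmk (d : B)
    have hprime : ∀ (c : p.primeCompl) (c' : MvPolynomial σ ℂ), mk c' = c → eval x c' ≠ 0 := by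
      intro c c' hc' h0
      refine c.2 ?_
      have h1 : c' ∈ p.comap mk := by
        rw [hp, mem_vanishingIdeal_singleton_iff, MvPolynomial.aeval_eq_eval]; exact h0
      rw [← hc']; exact h1
    have hc0 : eval x c' ≠ 0 := hprime c c' hc'
    have hd0 : eval x d' ≠ 0 := hprime d d' hd'
    rw [← hc', ← hd', ← map_mul, ← map_mul, ← map_mul, ← sub_eq_zero, ← map_sub,
      ← RingHom.mem_ker, hker] at hd
    have hI : d' * (f * c') - d' * g ∈ J := by
      refine ⟨?_, hT v hvT _ hd⟩
      have := hd x hx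
      rwa [MvPolynomial.aeval_eq_eval] at this
    have h1 : d' * (f * c') ∈ J := by
      have := add_mem hI (J.mul_mem_left d' hg)
      rwa [sub_add_cancel] at this
    obtain ⟨h2, h3⟩ := h1
    have hf0 : eval x f = 0 := by
      simpa [hc0, hd0] using h2
    refine ⟨hf0, ?_⟩
    rw [gradAt_mul, gradAt_mul] at h3
    simpa [hf0, hc0, hd0, smul_dotProduct] using h3
  refine hv0 (Subtype.ext (funext fun s => ?_))
  have hs : (MvPolynomial.X s - C (x s) : MvPolynomial σ ℂ) ∈ J := by
    refine hJ _ (hm ?_)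
    rw [show m = _ from maximalIdeal_eq_map_germ (R := R) p mk hmk hp]
    refine Ideal.mem_map_of_mem _ ?_
    rw [mem_vanishingIdeal_singleton_iff]; simp
  have := hs.2
  rw [gradAt_sub, gradAt_X, gradAt_C, sub_zero, single_dotProduct, one_mul] at this
  simpa using this

/-- A set cut out by `#E` equations in affine space has codimension at most `#E` at each of its
points (Krull's height theorem and the Nullstellensatz). -/
theorem card_le_ringKrullDim_localRing_add [IsNoetherianRing B]
    (hmk : Function.Surjective mk) (hker : RingHom.ker mk = vanishingIdeal ℂ X)
    (hp : p.comap mk = vanishingIdeal ℂ {x}) [Finite σ] {E : Type} [Finite E]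
    (f : E → MvPolynomial σ ℂ) (hX : X = {y | ∀ e, aeval y (f e) = 0}) :
    (Nat.card σ : WithBot ℕ∞) ≤ ringKrullDim R + Nat.card E := by
  classical
  have := Fintype.ofFinite E
  rw [IsLocalization.AtPrime.ringKrullDim_eq_height p R]
  obtain ⟨s, hs, hcard⟩ := p.exists_finset_card_eq_height_of_isNoetherianRing
  rw [← hcard]
  let I := vanishingIdeal ℂ X
  let lift : B → MvPolynomial σ ℂ := Function.surjInv hmk
  have hlift : ∀ b, mk (lift b) = b := Function.surjInv_eq hmk
  -- As `p` is a minimal prime over `s`, the ideal of `x` is a minimal prime over `S`.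
  let S : Finset (MvPolynomial σ ℂ) := Finset.univ.image f ∪ s.image lift
  have hI : ∀ q : Ideal (MvPolynomial σ ℂ), q.IsPrime → Ideal.span S ≤ q → I ≤ q := by
    intro q hq hle
    have h1 : X = zeroLocus ℂ (Ideal.span (Set.range f)) := by
      rw [zeroLocus_span, hX]; simp
    have h2 : I = (Ideal.span (Set.range f)).radical := by
      rw [← vanishingIdeal_zeroLocus_eq_radical (K := ℂ), ← h1]
    rw [h2, hq.radical_le_iff]
    refine le_trans (Ideal.span_mono ?_) hle
    rintro _ ⟨e, rfl⟩
    simp [S]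
  have hmem : vanishingIdeal ℂ {x} ∈ (Ideal.span (S : Set _)).minimalPrimes := by
    rw [← hp]
    refine ⟨⟨inferInstance, ?_⟩, ?_⟩
    · rw [Ideal.span_le]
      intro g hg
      simp only [S, Finset.coe_union, Finset.coe_image, Finset.coe_univ, Set.image_univ] at hg
      rcases hg with ⟨e, rfl⟩ | ⟨b, hb, rfl⟩
      · have h0 : f e ∈ I := by
          intro y hy
          rw [hX] at hy
          exact hy e
        rw [SetLike.mem_coe, Ideal.mem_comap, (RingHom.mem_ker).mp (hker.symm ▸ h0)]
        exact zero_mem _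
      · rw [SetLike.mem_coe, Ideal.mem_comap, hlift]
        exact hs.1.2 (Ideal.subset_span hb)
    · rintro q ⟨hq, hSq⟩ hle
      have hIq := hI q hq hSq
      have hker : RingHom.ker mk ≤ q := by rwa [hker]
      have hqp : (q.map mk).IsPrime := Ideal.map_isPrime_of_surjective hmk hker
      have h1 : Ideal.span (s : Set B) ≤ q.map mk := by
        rw [Ideal.span_le]
        intro b hb
        rw [← hlift b]
        refine Ideal.mem_map_of_mem _ (hSq (Ideal.subset_span ?_))
        simp only [S, Finset.coe_union, Finset.coe_image]
        exact Or.inr ⟨b, hb, rfl⟩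
      have h2 : q.map mk ≤ p := Ideal.map_le_iff_le_comap.mpr hle
      have h3 := hs.2 ⟨hqp, h1⟩ h2
      have h4 := Ideal.comap_mono (f := mk) h3
      rw [Ideal.comap_map_of_surjective _ hmk] at h4
      refine h4.trans (sup_le le_rfl ?_)
      exact hker
  have hht := Ideal.height_le_card_of_mem_minimalPrimes_span_finset hmem
  rw [MvPolynomial.height_vanishingIdeal_singleton] at hht
  have hS : S.card ≤ Nat.card E + s.card := by
    refine (Finset.card_union_le _ _).trans (add_le_add ?_ Finset.card_image_le)
    rw [Nat.card_eq_fintype_card]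
    exact Finset.card_image_le
  have hht : Nat.card σ ≤ S.card := by exact_mod_cast hht
  have : Nat.card σ ≤ s.card + Nat.card E := by omega
  exact_mod_cast this

end LocalRing

end AffineSet

end

/-! ### The degenerate flag variety in a standard chart -/

noncomputable section

section GraphSubspace

variable {K ι : Type*} [Field K] [DecidableEq ι] {s : Finset ι} {r : ι → ι → K}

/-- Membership in the graph of a linear map from the coordinate space of `s` to the one of its
complement, spanned by the rows `r a` (`a ∈ s`) of a matrix which is the identity on `s`. -/
theorem mem_span_rows_iff (hr : ∀ a ∈ s, ∀ b ∈ s, r a b = if a = b then 1 else 0) {v : ι → K} :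
    v ∈ Submodule.span K (Set.range fun a : {a // a ∈ s} => r a) ↔
      ∀ c ∉ s, v c = ∑ b ∈ s, v b * r b c := by
  constructor
  · intro hv c hc
    induction hv using Submodule.span_induction with
    | mem x hx =>
      obtain ⟨⟨a, ha⟩, rfl⟩ := hx
      rw [Finset.sum_eq_single a]
      · simp [hr a ha a ha]
      · intro b hb hba
        simp [hr a ha b hb, hba.symm]
      · exact fun h => absurd ha h
    | zero => simp
    | add x y _ _ hx hy => simp [hx, hy, add_mul, Finset.sum_add_distrib]
    | smul t x _ hx => simp [hx, Finset.mul_sum, mul_assoc]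
  · intro h
    have : v = ∑ a : {a // a ∈ s}, v a • r a := by
      funext c
      rw [Finset.sum_apply, Finset.sum_coe_sort s (fun a => (v a • r a) c)]
      by_cases hc : c ∈ s
      · rw [Finset.sum_eq_single c]
        · simp [hr c hc c hc]
        · intro b hb hbc
          simp [hr b hb c hc, hbc]
        · exact fun h => absurd hc h
      · simpa using h c hc
    rw [this]
    exact Submodule.sum_mem _ fun a _ => Submodule.smul_mem _ _ (Submodule.subset_span ⟨a, rfl⟩)

theorem finrank_span_rows (hr : ∀ a ∈ s, ∀ b ∈ s, r a b = if a = b then 1 else 0) :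
    Module.finrank K (Submodule.span K (Set.range fun a : {a // a ∈ s} => r a)) = s.card := by
  rw [finrank_span_eq_card, Fintype.card_coe]
  rw [Fintype.linearIndependent_iff]
  intro g hg ⟨a, ha⟩
  have h := congrFun hg a
  rw [Finset.sum_apply, Finset.sum_eq_single ⟨a, ha⟩] at h
  · simpa [hr a ha a ha] using h
  · rintro ⟨b, hb⟩ _ hba
    have : b ≠ a := fun h => hba (Subtype.ext h)
    simp [hr b hb a ha, this]
  · simp

end GraphSubspace

/-- The linear map which replaces the coordinate with (zero-based) index `m` by zero. The index is a
natural number, and the map is the identity if it is out of range. -/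
def killCoord (K : Type*) [Field K] {N : ℕ} (m : ℕ) : (Fin N → K) →ₗ[K] (Fin N → K) where
  toFun v := fun i => if (i : ℕ) = m then 0 else v i
  map_add' u v := by funext i; by_cases h : (i : ℕ) = m <;> simp [h]
  map_smul' c v := by funext i; by_cases h : (i : ℕ) = m <;> simp [h]

theorem killCoord_apply {K : Type*} [Field K] {N : ℕ} (m : ℕ) (v : Fin N → K) (i : Fin N) :
    killCoord K m v i = if (i : ℕ) = m then 0 else v i := rfl

namespace DegenerateFlag

variable {n : ℕ} (S : Fin n → Finset (Fin (n + 1)))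

/-- The matrix entries of the `k`-th subspace of the chart attached to `S`: the row indexed by
`a ∈ S k` is the vector `w_a + ∑ x_{ab} w_b`. Rows with `a ∉ S k` are zero and carry no
information. -/
def entry {A : Type*} [CommRing A] (x : ChartIndex S → A) (k : Fin n) (a b : Fin (n + 1)) : A :=
  if hb : b ∈ S k then if a = b then 1 else 0
  else if ha : a ∈ S k then x ⟨k, ⟨a, ha⟩, ⟨b, hb⟩⟩ else 0

/-- The index set of the equations of the degenerate flag variety in the chart attached to `S`. -/
abbrev EqIndex : Type :=
  Σ p : {p : Fin n × Fin n // (p.1 : ℕ) + 1 = p.2},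
    {a : Fin (n + 1) // a ∈ S p.1.1} × {c : Fin (n + 1) // c ∉ S p.1.2}

/-- The equations of the degenerate flag variety in the chart attached to `S`: the equation
with index `(k, l, a, c)` says that the projection of the row `a` of the `k`-th matrix has the
`c`-th coordinate required for lying in the `l`-th subspace. -/
def equation {A : Type*} [CommRing A] (x : ChartIndex S → A) (e : EqIndex S) : A :=
  (if (e.2.2 : Fin (n + 1)) = e.1.1.1.succ then 0 else entry S x e.1.1.1 e.2.1 e.2.2) -
    ∑ b ∈ S e.1.1.2, (if b = e.1.1.1.succ then 0 else entry S x e.1.1.1 e.2.1 b) *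
      entry S x e.1.1.2 b e.2.2

theorem map_entry {A B : Type*} [CommRing A] [CommRing B] (φ : A →+* B) (x : ChartIndex S → A)
    (k : Fin n) (a b : Fin (n + 1)) :
    φ (entry S x k a b) = entry S (fun i => φ (x i)) k a b := by
  unfold entry; split_ifs <;> simp

theorem map_equation {A B : Type*} [CommRing A] [CommRing B] (φ : A →+* B) (x : ChartIndex S → A)
    (e : EqIndex S) : φ (equation S x e) = equation S (fun i => φ (x i)) e := by
  unfold equation
  rw [map_sub, map_sum]
  congr 1
  · split_ifs
    · simp
    · exact map_entry S φ x _ _ _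
  · refine Finset.sum_congr rfl fun b _ => ?_
    rw [map_mul, map_entry]
    split_ifs
    · simp
    · rw [map_entry]

/-- The equations as polynomials in the coordinates of the chart. -/
def equationPoly (e : EqIndex S) : MvPolynomial (ChartIndex S) ℂ :=
  equation S MvPolynomial.X e

theorem aeval_equationPoly {A : Type*} [CommRing A] [Algebra ℂ A] (x : ChartIndex S → A)
    (e : EqIndex S) : MvPolynomial.aeval x (equationPoly S e) = equation S x e := by
  have := map_equation S (MvPolynomial.aeval (R := ℂ) x).toRingHom MvPolynomial.X e
  simpa [equationPoly] using this

/-- The `k`-th subspace with coordinates `x` in the chart attached to `S`, over any field. -/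
def rowSpan {K : Type*} [Field K] (x : ChartIndex S → K) (k : Fin n) :
    Submodule K (Fin (n + 1) → K) :=
  Submodule.span K (Set.range fun a : {a // a ∈ S k} => entry S x k a)

theorem entry_eq_ite {A : Type*} [CommRing A] (x : ChartIndex S → A) (k : Fin n) :
    ∀ a ∈ S k, ∀ b ∈ S k, entry S x k a b = if a = b then 1 else 0 :=
  fun a _ b hb => by simp [entry, hb]

theorem map_killCoord_rowSpan_le_iff {K : Type*} [Field K] (x : ChartIndex S → K) (k l : Fin n)
    (hkl : (k : ℕ) + 1 = l) :
    (rowSpan S x k).map (killCoord K ((k : ℕ) + 1)) ≤ rowSpan S x l ↔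
      ∀ (a : {a : Fin (n + 1) // a ∈ S k}) (c : {c : Fin (n + 1) // c ∉ S l}),
        equation S x ⟨⟨(k, l), hkl⟩, a, c⟩ = 0 := by
  have hval : ∀ b : Fin (n + 1), (b : ℕ) = k + 1 ↔ b = k.succ := fun b => by
    rw [Fin.ext_iff, Fin.val_succ]
  rw [rowSpan, Submodule.map_span_le]
  simp only [Set.forall_mem_range, rowSpan]
  refine forall_congr' fun a => ?_
  rw [mem_span_rows_iff (entry_eq_ite S x l), Subtype.forall]
  refine forall₂_congr fun c hc => ?_
  simp only [killCoord_apply, hval, equation, sub_eq_zero]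

theorem chart_eq_rowSpan (x : ChartIndex S → ℂ) (k : Fin n) : chart S x k = rowSpan S x k := by
  unfold chart rowSpan
  congr 2
  funext a c
  rw [Pi.add_apply, Finset.sum_apply]
  by_cases hc : c ∈ S k
  · rw [Finset.sum_eq_zero]
    · simp [w, entry, hc, Pi.single_apply, eq_comm]
    · rintro ⟨b, hb⟩ _
      have : c ≠ b := fun h => hb (h ▸ hc)
      simp [w, this]
  · rw [Finset.sum_eq_single ⟨c, hc⟩]
    · have : c ≠ a := fun h => hc (h ▸ a.2)
      simp [w, entry, hc, this, a.2]
    · rintro ⟨b, hb⟩ _ hbc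
      have : c ≠ b := fun h => hbc (Subtype.ext h.symm)
      simp [w, this]
    · simp

theorem preimage_chart_eq (hS : IsCollection S) :
    chart S ⁻¹' degenerateFlagVariety n =
      {y | ∀ e, MvPolynomial.aeval y (equationPoly S e) = 0} := by
  have hpr : ∀ k : Fin n, (pr k.succ : W n →ₗ[ℂ] W n) = killCoord ℂ ((k : ℕ) + 1) := by
    intro k
    refine LinearMap.ext fun v => funext fun j => ?_
    simp only [pr, LinearMap.coe_mk, AddHom.coe_mk, killCoord_apply, Fin.ext_iff, Fin.val_succ]
  ext y
  simp only [Set.mem_preimage, degenerateFlagVariety, grassmannianProduct, Set.mem_ofPred_eq,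
    chart_eq_rowSpan, hpr, aeval_equationPoly]
  constructor
  · rintro ⟨-, h⟩ ⟨⟨⟨k, l⟩, hkl⟩, a, c⟩
    exact (map_killCoord_rowSpan_le_iff S y k l hkl).mp (h k l hkl) a c
  · refine fun h => ⟨fun k => ?_, fun k l hkl => ?_⟩
    · rw [chart_eq_rowSpan]
      exact (finrank_span_rows (entry_eq_ite S y k)).trans (hS k)
    · exact (map_killCoord_rowSpan_le_iff S y k l hkl).mpr fun a c => h _

/-- The chart attached to `S` is the only standard chart containing the torus-fixed point of `S`. -/
theorem chart_eq_fixedPoint {J : Fin n → Finset (Fin (n + 1))} (hJ : IsCollection J)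
    (hS : IsCollection S) {x : ChartIndex J → ℂ} (h : chart J x = fixedPoint S) : J = S := by
  funext k
  refine Finset.eq_of_subset_of_card_le (fun a ha => ?_) (by rw [hJ k, hS k])
  have h1 : entry J x k a ∈ fixedPoint S k := by
    rw [← h, chart_eq_rowSpan]
    exact Submodule.subset_span ⟨⟨a, ha⟩, rfl⟩
  by_contra haS
  have h2 : ∀ v ∈ fixedPoint S k, v a = 0 := by
    intro v hv
    induction hv using Submodule.span_induction with
    | mem v hv =>
      obtain ⟨i, hi, rfl⟩ := hv
      have : a ≠ i := fun h => haS (h ▸ hi)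
      simp [w, this]
    | zero => rfl
    | add u v _ _ hu hv => simp [hu, hv]
    | smul t v _ hv => simp [hv]
  have h3 := h2 _ h1
  simp [entry, ha] at h3

theorem chart_zero : chart S (0 : ChartIndex S → ℂ) = fixedPoint S := by
  funext k
  simp only [chart, fixedPoint, Pi.zero_apply, zero_smul, Finset.sum_const_zero, add_zero]
  congr 1
  ext v
  simp

theorem chart_eq_fixedPoint_iff {x : ChartIndex S → ℂ} :
    chart S x = fixedPoint S ↔ x = 0 := by
  refine ⟨fun h => ?_, fun h => h ▸ chart_zero S⟩
  funext ⟨k, ⟨a, ha⟩, ⟨b, hb⟩⟩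
  have h1 : entry S x k a ∈ rowSpan S 0 k := by
    rw [← chart_eq_rowSpan, chart_zero, ← h, chart_eq_rowSpan]
    exact Submodule.subset_span ⟨⟨a, ha⟩, rfl⟩
  rw [rowSpan, mem_span_rows_iff (entry_eq_ite S 0 k)] at h1
  have h2 := h1 b hb
  rw [Finset.sum_eq_zero] at h2
  · simpa [entry, ha, hb] using h2
  · intro c _
    have : entry S (0 : ChartIndex S → ℂ) k c b = 0 := by simp [entry, hb]
    rw [this, mul_zero]

end DegenerateFlag

end

/-! ### Fields of definition of subspaces -/

section

section LinearAlgebra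

variable {K E : Type*} [Field K] [AddCommGroup E] [Module K E] [FiniteDimensional K E]

theorem finrank_sup_span_singleton_of_notMem {A : Submodule K E} {v : E} (hv : v ∉ A) :
    Module.finrank K (A ⊔ Submodule.span K {v} : Submodule K E) = Module.finrank K A + 1 := by
  have h1 : A < A ⊔ Submodule.span K {v} := by
    refine lt_of_le_of_ne le_sup_left fun h => hv ?_
    rw [h]
    exact Submodule.mem_sup_right (Submodule.mem_span_singleton_self v)
  have h2 := Submodule.finrank_lt_finrank_of_lt h1
  have h3 := Submodule.finrank_add_le_finrank_add_finrank A (Submodule.span K {v})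
  have h4 := finrank_span_le_card (R := K) ({v} : Set E)
  simp only [Set.toFinset_singleton, Finset.card_singleton] at h4
  omega

theorem exists_submodule_finrank_eq_between {A B : Submodule K E} (hAB : A ≤ B) {m : ℕ}
    (hA : Module.finrank K A ≤ m) (hB : m ≤ Module.finrank K B) :
    ∃ D : Submodule K E, A ≤ D ∧ D ≤ B ∧ Module.finrank K D = m := by
  obtain ⟨d, rfl⟩ := Nat.exists_eq_add_of_le hA
  clear hA
  induction d generalizing A with
  | zero => exact ⟨A, le_rfl, hAB, rfl⟩
  | succ d ih =>
    have hlt : ¬ B ≤ A := fun h => by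
      have := Submodule.finrank_mono h
      omega
    obtain ⟨v, hvB, hvA⟩ := Set.not_subset.mp hlt
    have h1 := finrank_sup_span_singleton_of_notMem hvA
    obtain ⟨D, hD1, hD2, hD3⟩ := ih (A := A ⊔ Submodule.span K {v})
      (sup_le hAB (by simpa using hvB)) (by omega)
    exact ⟨D, le_sup_left.trans hD1, hD2, by omega⟩

theorem finrank_le_finrank_inf_ker_add_one (D : Submodule K E) (φ : E →ₗ[K] K) :
    Module.finrank K D ≤ Module.finrank K (D ⊓ LinearMap.ker φ : Submodule K E) + 1 := by
  have h1 := (φ.domRestrict D).finrank_range_add_finrank_ker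
  have h2 : Module.finrank K (LinearMap.range (φ.domRestrict D)) ≤ 1 := by
    simpa using Submodule.finrank_le (LinearMap.range (φ.domRestrict D))
  have h3 : (LinearMap.ker (φ.domRestrict D)).map D.subtype = D ⊓ LinearMap.ker φ := by
    ext v
    simp only [Submodule.mem_map, LinearMap.mem_ker, LinearMap.domRestrict_apply,
      Submodule.subtype_apply, Submodule.mem_inf]
    constructor
    · rintro ⟨y, hy, rfl⟩; exact ⟨y.2, hy⟩
    · rintro ⟨hv, hv'⟩; exact ⟨⟨v, hv⟩, hv', rfl⟩
  have h4 := LinearEquiv.finrank_eq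
    (Submodule.equivMapOfInjective D.subtype D.injective_subtype (LinearMap.ker (φ.domRestrict D)))
  rw [h3] at h4
  omega

end LinearAlgebra

/-- Dependent choice for finitely many steps. -/
theorem exists_seq_of_forall_lt_exists {α : Type*} (P : ℕ → α → Prop) (r : ℕ → α → α → Prop) (N : ℕ)
    (a : α) (h0 : P 0 a) (hs : ∀ d < N, ∀ x, P d x → ∃ y, P (d + 1) y ∧ r d x y) :
    ∃ f : ℕ → α, f 0 = a ∧ (∀ d ≤ N, P d (f d)) ∧ ∀ d < N, r d (f d) (f (d + 1)) := by
  classical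
  let g : ℕ → α → α := fun d x => if h : ∃ y, P (d + 1) y ∧ r d x y then h.choose else x
  let f : ℕ → α := fun d => Nat.rec a g d
  have hg : ∀ d x, (∃ y, P (d + 1) y ∧ r d x y) → P (d + 1) (g d x) ∧ r d x (g d x) := by
    intro d x h
    simp only [g, dif_pos h]
    exact h.choose_spec
  have hP : ∀ d ≤ N, P d (f d) := by
    intro d
    induction d with
    | zero => exact fun _ => h0
    | succ d ih => exact fun hd => (hg d (f d) (hs d hd _ (ih (by omega)))).1
  exact ⟨f, rfl, hP, fun d hd => (hg d (f d) (hs d hd _ (hP d hd.le))).2⟩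

section Rationality

variable {k K ι : Type*} [Field k] [Field K] [Algebra k K]

/-- A subspace of `K^ι` is defined over the intermediate field `L` if it is spanned by vectors
with coordinates in `L`. -/
def IsDefinedOver (L : IntermediateField k K) (V : Submodule K (ι → K)) : Prop :=
  V ≤ Submodule.span K {v | v ∈ V ∧ ∀ i, v i ∈ L}

theorem IsDefinedOver.mono {L L' : IntermediateField k K} (h : L ≤ L') {V : Submodule K (ι → K)}
    (hV : IsDefinedOver L V) : IsDefinedOver L' V :=
  hV.trans (Submodule.span_mono fun _ hv => ⟨hv.1, fun i => h (hv.2 i)⟩)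

theorem isDefinedOver_span {L : IntermediateField k K} {s : Set (ι → K)}
    (hs : ∀ v ∈ s, ∀ i, v i ∈ L) : IsDefinedOver L (Submodule.span K s) :=
  Submodule.span_mono fun v hv => ⟨Submodule.subset_span hv, hs v hv⟩

theorem IsDefinedOver.sup {L : IntermediateField k K} {A B : Submodule K (ι → K)}
    (hA : IsDefinedOver L A) (hB : IsDefinedOver L B) : IsDefinedOver L (A ⊔ B) :=
  sup_le (hA.trans (Submodule.span_mono fun _ hv => ⟨Submodule.mem_sup_left hv.1, hv.2⟩))
    (hB.trans (Submodule.span_mono fun _ hv => ⟨Submodule.mem_sup_right hv.1, hv.2⟩))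

theorem IsDefinedOver.exists_notMem {L : IntermediateField k K} {B V : Submodule K (ι → K)}
    (hB : IsDefinedOver L B) (h : ¬ B ≤ V) : ∃ b ∈ B, (∀ i, b i ∈ L) ∧ b ∉ V := by
  by_contra! hcon
  exact h (hB.trans (Submodule.span_le.mpr fun v hv => hcon v hv.1 hv.2))

/-- A subspace `V` with `A ⊆ V ⊆ B`, `dim V = dim A + 1` and `dim B ≤ dim A + 2` corresponds to a
point of the projective line `ℙ(B / A)`, or of a single point; it is therefore defined over the
field generated by one additional parameter. -/
theorem exists_parameter_of_between [Finite ι] {L : IntermediateField k K}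
    {A V B : Submodule K (ι → K)} (hAV : A ≤ V) (hVB : V ≤ B) (hA : IsDefinedOver L A)
    (hB : IsDefinedOver L B) (h1 : Module.finrank K V = Module.finrank K A + 1)
    (h2 : Module.finrank K B ≤ Module.finrank K A + 2) :
    ∃ t : K, ∀ L' : IntermediateField k K, L ≤ L' → t ∈ L' → IsDefinedOver L' V := by
  by_cases hBV : B ≤ V
  · obtain rfl : V = B := le_antisymm hVB hBV
    exact ⟨0, fun L' hL' _ => hB.mono hL'⟩
  obtain ⟨b₁, hb₁, hb₁L, hb₁V⟩ := hB.exists_notMem hBV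
  have hA1 := finrank_sup_span_singleton_of_notMem (fun h => hb₁V (hAV h) : b₁ ∉ A)
  have hlt : Module.finrank K V < Module.finrank K B :=
    Submodule.finrank_lt_finrank_of_lt (lt_of_le_not_ge hVB hBV)
  obtain ⟨b₂, hb₂, hb₂L, hb₂A⟩ := hB.exists_notMem (V := A ⊔ Submodule.span K {b₁}) fun h => by
    have := Submodule.finrank_mono h
    omega
  have hA2 := finrank_sup_span_singleton_of_notMem hb₂A
  have hAB : A ⊔ Submodule.span K {b₁} ⊔ Submodule.span K {b₂} = B := by
    refine Submodule.eq_of_le_of_finrank_le ?_ (by omega)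
    refine sup_le (sup_le (hAV.trans hVB) ?_) ?_
    · simpa using hb₁
    · simpa using hb₂
  obtain ⟨v, hvV, hvA⟩ : ∃ v ∈ V, v ∉ A := by
    by_contra! h
    have := Submodule.finrank_mono (show V ≤ A from h)
    omega
  have hvB := hVB hvV
  rw [← hAB] at hvB
  obtain ⟨y, hy, z, hz, rfl⟩ := Submodule.mem_sup.mp hvB
  obtain ⟨a, ha, y', hy', rfl⟩ := Submodule.mem_sup.mp hy
  obtain ⟨p, rfl⟩ := Submodule.mem_span_singleton.mp hy'
  obtain ⟨q, rfl⟩ := Submodule.mem_span_singleton.mp hz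
  have hpq : p • b₁ + q • b₂ ∈ V := by
    have := V.sub_mem hvV (hAV ha)
    rwa [show a + p • b₁ + q • b₂ - a = p • b₁ + q • b₂ by abel] at this
  have hq : q ≠ 0 := by
    rintro rfl
    rw [zero_smul, add_zero] at hpq
    rcases eq_or_ne p 0 with rfl | hp
    · exact hvA (by simpa using ha)
    · exact hb₁V ((V.smul_mem_iff hp).mp hpq)
  have hu : b₂ + (q⁻¹ * p) • b₁ ∈ V := by
    have := V.smul_mem q⁻¹ hpq
    rwa [smul_add, smul_smul, smul_smul, inv_mul_cancel₀ hq, one_smul, add_comm] at this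
  have huA : b₂ + (q⁻¹ * p) • b₁ ∉ A := fun h => hb₂A (by
    have := Submodule.sub_mem _ (Submodule.mem_sup_left h : _ ∈ A ⊔ Submodule.span K {b₁})
      (Submodule.mem_sup_right (Submodule.smul_mem _ (q⁻¹ * p)
        (Submodule.mem_span_singleton_self b₁)))
    rwa [add_sub_cancel_right] at this)
  have hV : A ⊔ Submodule.span K {b₂ + (q⁻¹ * p) • b₁} = V := by
    refine Submodule.eq_of_le_of_finrank_le (sup_le hAV (by simpa using hu)) ?_
    rw [finrank_sup_span_singleton_of_notMem huA, h1]
  refine ⟨q⁻¹ * p, fun L' hL' ht => ?_⟩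
  rw [← hV]
  refine (hA.mono hL').sup (isDefinedOver_span ?_)
  rintro _ rfl i
  exact add_mem (hL' (hb₂L i)) (mul_mem ht (hL' (hb₁L i)))

/-- The matrix entries of a graph subspace lie in each of its fields of definition: as the rational
vectors span the subspace, their projections fill `L^s`, so that the row `a`, which is the only
vector of the subspace projecting to the `a`-th basis vector, is rational. -/
theorem IsDefinedOver.row_mem [DecidableEq ι] {s : Finset ι} {r : ι → ι → K}
    (hr : ∀ a ∈ s, ∀ b ∈ s, r a b = if a = b then 1 else 0) {L : IntermediateField k K}
    (hV : IsDefinedOver L (Submodule.span K (Set.range fun a : {a // a ∈ s} => r a)))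
    {a : ι} (ha : a ∈ s) (c : ι) : r a c ∈ L := by
  let V := Submodule.span K (Set.range fun a : {a // a ∈ s} => r a)
  -- The projections to `L^s` of the `L`-rational vectors of `V`.
  let Z : Submodule L (s → L) :=
    { carrier := {z | ∃ v ∈ V, (∀ i, v i ∈ L) ∧ ∀ b : s, v b = z b}
      zero_mem' := ⟨0, V.zero_mem, fun i => L.zero_mem, fun b => rfl⟩
      add_mem' := by
        rintro y z ⟨u, hu, huL, huy⟩ ⟨v, hv, hvL, hvz⟩
        exact ⟨u + v, V.add_mem hu hv, fun i => add_mem (huL i) (hvL i), fun b => by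
          simp [huy b, hvz b]⟩
      smul_mem' := by
        rintro t z ⟨v, hv, hvL, hvz⟩
        exact ⟨(t : K) • v, V.smul_mem _ hv, fun i => mul_mem t.2 (hvL i), fun b => by
          simp [hvz b]⟩ }
  have hZ : Z = ⊤ := by
    by_contra hne
    obtain ⟨φ, hφ0, hφ⟩ := Submodule.exists_le_ker_of_lt_top Z (lt_top_iff_ne_top.mpr hne)
    let Φ : (ι → K) →ₗ[K] K :=
      ∑ b : s, ((φ (Pi.single b 1) : L) : K) • LinearMap.proj (R := K) (φ := fun _ => K) (b : ι)
    have hΦ : V ≤ LinearMap.ker Φ := by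
      refine hV.trans (Submodule.span_le.mpr ?_)
      rintro v ⟨hv, hvL⟩
      have h1 : φ (fun b => ⟨v b, hvL b⟩) = 0 := hφ ⟨v, hv, hvL, fun b => rfl⟩
      rw [LinearMap.pi_apply_eq_sum_univ φ] at h1
      have h2 := congrArg (algebraMap L K) h1
      rw [map_sum, map_zero] at h2
      rw [SetLike.mem_coe, LinearMap.mem_ker, ← h2, LinearMap.sum_apply]
      refine Finset.sum_congr rfl fun b _ => ?_
      have : (fun j => if b = j then (1 : L) else 0) = Pi.single b 1 := by
        funext j; simp [Pi.single_apply, eq_comm]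
      simp [this, mul_comm]
    refine hφ0 (LinearMap.pi_ext' fun b => LinearMap.ext_ring ?_)
    have h1 : Φ (r b) = 0 := hΦ (Submodule.subset_span ⟨b, rfl⟩)
    rw [LinearMap.sum_apply, Finset.sum_eq_single b] at h1
    · have h2 : ((φ (Pi.single b 1) : L) : K) = 0 := by
        simpa [hr b b.2 b b.2] using h1
      simpa using h2
    · intro c _ hcb
      have : (b : ι) ≠ c := fun h => hcb (Subtype.ext h.symm)
      simp [hr b b.2 c c.2, this]
    · simp
  obtain ⟨v, hv, hvL, hvz⟩ : (Pi.single ⟨a, ha⟩ 1 : s → L) ∈ Z := hZ ▸ Submodule.mem_top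
  by_cases hc : c ∈ s
  · rw [hr a ha c hc]
    split_ifs
    · exact L.one_mem
    · exact L.zero_mem
  · have h1 := (mem_span_rows_iff hr).mp hv c hc
    rw [Finset.sum_eq_single a] at h1
    · rw [hvz ⟨a, ha⟩] at h1
      have : v c = r a c := by simpa using h1
      rw [← this]
      exact hvL c
    · intro b hb hba
      rw [hvz ⟨b, hb⟩]
      have : (⟨b, hb⟩ : s) ≠ ⟨a, ha⟩ := fun h => hba (congrArg Subtype.val h)
      simp [this]
    · exact fun h => absurd ha h

end Rationality

end

/-! ### Counting the parameters of a degenerate flag -/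

noncomputable section

section Resolution

variable {K : Type*} [Field K] {N : ℕ}

/-- The vectors whose coordinates with (zero-based) index in the interval `[i, j)` vanish. -/
def vanishOn (K : Type*) [Field K] (N i j : ℕ) : Submodule K (Fin N → K) where
  carrier := {v | ∀ m : Fin N, i ≤ m → (m : ℕ) < j → v m = 0}
  zero_mem' _ _ _ := rfl
  add_mem' hu hv m h1 h2 := by simp [hu m h1 h2, hv m h1 h2]
  smul_mem' t v hv m h1 h2 := by simp [hv m h1 h2]

/-- The condition on the `j`-th column `C i = V_{ij}`, `i ≤ j`, of a triangular array of subspaces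
lying over the degenerate flag `U`: it is a complete flag of `U j`, and `C i` is contained in the
span of the basis vectors number `1, …, i` and `j + 1, …, N`. -/
structure IsColumn (U : ℕ → Submodule K (Fin N → K)) (j : ℕ) (C : ℕ → Submodule K (Fin N → K)) :
    Prop where
  top : C j = U j
  finrank : ∀ i ≤ j, Module.finrank K (C i) = i
  le_vanishOn : ∀ i ≤ j, C i ≤ vanishOn K N i j
  le_succ : ∀ i < j, C i ≤ C (i + 1)

variable {U : ℕ → Submodule K (Fin N → K)}

/-- The entry `C' i` of the next column is chosen between the projection of `C i` and the vectors of
`C' (i + 1)` whose coordinate of index `i` vanishes; the latter space has dimension at least `i`. -/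
theorem IsColumn.exists_next {j : ℕ} (hj : j < N) {C : ℕ → Submodule K (Fin N → K)}
    (hC : IsColumn U j C) (hdim : Module.finrank K (U (j + 1)) = j + 1)
    (hU : (U j).map (killCoord K j) ≤ U (j + 1)) :
    ∃ C', IsColumn U (j + 1) C' ∧ ∀ i ≤ j, (C i).map (killCoord K j) ≤ C' i := by
  -- The new column is chosen from its bottom entry `U (j + 1)` upwards.
  obtain ⟨D, hD0, hDP, hDr⟩ := exists_seq_of_forall_lt_exists
    (fun d (D : Submodule K (Fin N → K)) => Module.finrank K D = j + 1 - d ∧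
      D ≤ vanishOn K N (j + 1 - d) (j + 1) ∧ (C (j - d)).map (killCoord K j) ≤ D)
    (fun d D D' => D' ≤ D ∧ (C (j - d)).map (killCoord K j) ≤ D') (j + 1) (U (j + 1))
    ⟨by simpa using hdim, fun v _ m h1 h2 => by omega, by simpa [hC.top] using hU⟩ (by
      rintro d hd D ⟨hfr, hvan, hle⟩
      have hd' : j - d < N := by omega
      let φ : (Fin N → K) →ₗ[K] K := LinearMap.proj (⟨j - d, hd'⟩ : Fin N)
      have h1 := finrank_le_finrank_inf_ker_add_one D φ
      have h2 : (C (j - d)).map (killCoord K j) ≤ D ⊓ LinearMap.ker φ := by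
        refine le_inf hle ?_
        rintro _ ⟨v, hv, rfl⟩
        change (if j - d = j then 0 else v ⟨j - d, hd'⟩) = 0
        split_ifs with h
        · rfl
        · exact hC.le_vanishOn _ (Nat.sub_le j d) hv ⟨j - d, hd'⟩ le_rfl
            (show j - d < j by omega)
      have h3 : Module.finrank K ((C (j - d)).map (killCoord K j)) ≤ j - d :=
        (Submodule.finrank_map_le _ _).trans (hC.finrank _ (Nat.sub_le j d)).le
      obtain ⟨D', hD1, hD2, hD3⟩ := exists_submodule_finrank_eq_between h2 h3 (by omega)
      have hsub : j + 1 - (d + 1) = j - d := by omega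
      refine ⟨D', ⟨by omega, ?_, ?_⟩, hD2.trans inf_le_left, hD1⟩
      · intro v hv m hm1 hm2
        rcases Nat.eq_or_lt_of_le hm1 with h | h
        · have h4 : φ v = 0 := (hD2 hv).2
          have h5 : m = ⟨j - d, hd'⟩ := Fin.ext (by simp only; omega)
          rw [h5]; exact h4
        · exact hvan (hD2 hv).1 m (by omega) hm2
      · refine le_trans (Submodule.map_mono ?_) hD1
        rcases Nat.lt_or_ge d j with h | h
        · have h6 := hC.le_succ (j - (d + 1)) (by omega)
          rwa [show j - (d + 1) + 1 = j - d by omega] at h6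
        · rw [show j - (d + 1) = j - d by omega])
  refine ⟨fun i => D (j + 1 - i), ⟨?_, ?_, ?_, ?_⟩, ?_⟩
  · simpa using hD0
  · intro i hi
    rw [(hDP (j + 1 - i) (Nat.sub_le _ _)).1]; omega
  · intro i hi
    have h := (hDP (j + 1 - i) (Nat.sub_le _ _)).2.1
    rwa [show j + 1 - (j + 1 - i) = i by omega] at h
  · intro i hi
    have h := (hDr (j - i) (by omega)).1
    rwa [show j - i + 1 = j + 1 - i by omega, show j - i = j + 1 - (i + 1) by omega] at h
  · intro i hi
    have h := (hDr (j - i) (by omega)).2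
    rwa [show j - i + 1 = j + 1 - i by omega, show j - (j - i) = i by omega] at h

/-- Every degenerate flag lifts to a triangular array of subspaces `V_{ij}` (written `V j i`). As
`V_{i-1,j} ⊆ V_{ij} ⊆ V_{i,j+1} + ⟨w⟩`, where `w` is the basis vector that is projected away between
the columns, each entry is a point of a projective line once the next column and the preceding entry
of its own column are given. -/
theorem exists_columns {n : ℕ} (hn : n ≤ N) (hdim : ∀ j ≤ n, Module.finrank K (U j) = j)
    (hU : ∀ j < n, (U j).map (killCoord K j) ≤ U (j + 1)) :
    ∃ V : ℕ → ℕ → Submodule K (Fin N → K), (∀ j ≤ n, IsColumn U j (V j)) ∧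
      ∀ j < n, ∀ i ≤ j, (V j i).map (killCoord K j) ≤ V (j + 1) i := by
  have h0 : IsColumn U 0 (fun _ => U 0) :=
    ⟨rfl, fun i hi => by rw [Nat.le_zero.mp hi]; exact hdim 0 (Nat.zero_le n),
      fun i hi v _ m h1 h2 => by omega, fun i hi => by omega⟩
  obtain ⟨V, -, hP, hr⟩ := exists_seq_of_forall_lt_exists (fun j C => IsColumn U j C)
    (fun j C C' => ∀ i ≤ j, (C i).map (killCoord K j) ≤ C' i) n _ h0
    fun j hj C hC => hC.exists_next (by omega) (hdim (j + 1) hj) (hU j hj)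
  exact ⟨V, hP, hr⟩

variable {k : Type*} [Field k] [Algebra k K]

/-- The parameters of one column: if subspaces `B i` of dimension at most `i + 1` containing the
entries `C i` are defined over `k(T)`, then the column is defined over `k(T')` for a set `T'` with
at most `j` more elements. -/
theorem IsColumn.exists_parameters {j : ℕ} {C : ℕ → Submodule K (Fin N → K)} (hC : IsColumn U j C)
    (T : Finset K) (B : ℕ → Submodule K (Fin N → K)) (hCB : ∀ i ≤ j, C i ≤ B i)
    (hfr : ∀ i ≤ j, Module.finrank K (B i) ≤ i + 1)
    (hB : ∀ i ≤ j, IsDefinedOver (IntermediateField.adjoin k (T : Set K)) (B i)) :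
    ∃ T' : Finset K, T ⊆ T' ∧ T'.card ≤ T.card + j ∧
      ∀ i ≤ j, IsDefinedOver (IntermediateField.adjoin k (T' : Set K)) (C i) := by
  classical
  suffices H : ∀ d ≤ j, ∃ T' : Finset K, T ⊆ T' ∧ T'.card ≤ T.card + d ∧
      ∀ i ≤ d, IsDefinedOver (IntermediateField.adjoin k (T' : Set K)) (C i) from H j le_rfl
  intro d
  induction d with
  | zero =>
    refine fun _ => ⟨T, subset_rfl, le_rfl, fun i hi => ?_⟩
    obtain rfl := Nat.le_zero.mp hi
    have h0 : C 0 = ⊥ := Submodule.finrank_eq_zero.mp (hC.finrank 0 (Nat.zero_le j))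
    rw [IsDefinedOver, h0]
    exact bot_le
  | succ d ih =>
    intro hd
    obtain ⟨T', hT, hcard, hdef⟩ := ih (by omega)
    have hmono : IntermediateField.adjoin k (T : Set K) ≤ IntermediateField.adjoin k (T' : Set K) :=
      IntermediateField.adjoin.mono k _ _ (by exact_mod_cast hT)
    obtain ⟨t, ht⟩ := exists_parameter_of_between (hC.le_succ d (by omega)) (hCB (d + 1) hd)
      (hdef d le_rfl) ((hB (d + 1) hd).mono hmono)
      (by rw [hC.finrank (d + 1) hd, hC.finrank d (by omega)])
      (by rw [hC.finrank d (by omega)]; exact hfr (d + 1) hd)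
    have hsub : (T' : Set K) ⊆ (insert t T' : Finset K) := by simp
    have hmono' := IntermediateField.adjoin.mono k _ _ hsub
    refine ⟨insert t T', hT.trans (Finset.subset_insert t T'),
      (Finset.card_insert_le t T').trans (by omega), fun i hi => ?_⟩
    rcases Nat.lt_or_ge d i with h | h
    · obtain rfl : i = d + 1 := by omega
      exact ht _ hmono' (IntermediateField.subset_adjoin k _ (by simp))
    · exact (hdef i h).mono hmono'

/-- A degenerate flag over an extension field of `k` is defined over an extension generated by
`0 + 1 + ⋯ + n` elements: one parameter for each entry of positive dimension of a triangular array
over it. -/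
theorem exists_parameters_of_degenerateFlag {n : ℕ} {U : ℕ → Submodule K (Fin (n + 1) → K)}
    (hdim : ∀ j ≤ n, Module.finrank K (U j) = j)
    (hU : ∀ j < n, (U j).map (killCoord K j) ≤ U (j + 1)) :
    ∃ T : Finset K, T.card ≤ ∑ j ∈ Finset.range (n + 1), j ∧
      ∀ j ≤ n, IsDefinedOver (IntermediateField.adjoin k (T : Set K)) (U j) := by
  classical
  obtain ⟨V, hcol, hrow⟩ := exists_columns (Nat.le_succ n) hdim hU
  let e : Fin (n + 1) → (Fin (n + 1) → K) := fun m => Pi.single m 1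
  -- `F i` is the span of the first `i` basis vectors; it serves as column `n + 1`.
  let F : ℕ → Submodule K (Fin (n + 1) → K) := fun i =>
    Submodule.span K (e '' {m | (m : ℕ) < i})
  let R : ℕ → ℕ → Submodule K (Fin (n + 1) → K) := fun j i => if j < n then V (j + 1) i else F i
  have hR1 : ∀ j < n, ∀ i, R j i = V (j + 1) i := fun j h i => if_pos h
  have hR2 : ∀ i, R n i = F i := fun i => if_neg (lt_irrefl n)
  have hrat : ∀ (L : IntermediateField k K) (m i : Fin (n + 1)), e m i ∈ L := by
    intro L m i
    by_cases h : i = m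
    · subst h; simp [e]
    · simp [e, h]
  have hFfr : ∀ i ≤ n, Module.finrank K (F i) ≤ i := by
    intro i hi
    have h1 := finrank_span_le_card (R := K) (e '' {m : Fin (n + 1) | (m : ℕ) < i})
    refine h1.trans ?_
    rw [Set.toFinset_image]
    refine Finset.card_image_le.trans ?_
    have h2 : ({m : Fin (n + 1) | (m : ℕ) < i}).toFinset.card ≤ (Finset.range i).card :=
      Finset.card_le_card_of_injOn Fin.val (by intro m hm; simpa using hm) Fin.val_injective.injOn
    simpa using h2
  have hRle : ∀ j ≤ n, ∀ i ≤ j, (V j i).map (killCoord K j) ≤ R j i := by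
    intro j hj i hi
    by_cases h : j < n
    · rw [hR1 j h]; exact hrow j h i hi
    · obtain rfl : j = n := by omega
      rw [hR2]
      rintro _ ⟨v, hv, rfl⟩
      have h1 : killCoord K j v = ∑ m, killCoord K j v m • e m := by
        funext c
        simp [e, Finset.sum_apply, Pi.single_apply]
      rw [h1]
      refine Submodule.sum_mem _ fun m _ => ?_
      by_cases hm : (m : ℕ) < i
      · exact Submodule.smul_mem _ _ (Submodule.subset_span ⟨m, hm, rfl⟩)
      · have : killCoord K j v m = 0 := by
          rw [killCoord_apply]
          split_ifs with h2
          · rfl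
          · exact (hcol j le_rfl).le_vanishOn i hi hv m (by omega) (by omega)
        simp [this]
  have hRfr : ∀ j ≤ n, ∀ i ≤ j, Module.finrank K (R j i) ≤ i := by
    intro j hj i hi
    by_cases h : j < n
    · rw [hR1 j h]
      exact ((hcol (j + 1) h).finrank i (by omega)).le
    · obtain rfl : j = n := by omega
      rw [hR2]
      exact hFfr i hi
  -- The columns are adjoined from right to left.
  have key : ∀ d ≤ n + 1, ∃ T : Finset K,
      T.card ≤ ∑ j ∈ Finset.Ico (n + 1 - d) (n + 1), j ∧
      ∀ j, n + 1 - d ≤ j → j ≤ n → ∀ i ≤ j,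
        IsDefinedOver (IntermediateField.adjoin k (T : Set K)) (V j i) := by
    intro d
    induction d with
    | zero => exact fun _ => ⟨∅, by simp, fun j h1 h2 => by omega⟩
    | succ d ih =>
      intro hd
      obtain ⟨T, hcard, hdef⟩ := ih (by omega)
      obtain ⟨j, hj⟩ : ∃ j, n + 1 - (d + 1) = j := ⟨_, rfl⟩
      have hj' : n + 1 - d = j + 1 := by omega
      rw [hj'] at hcard hdef
      rw [hj]
      have hjn : j ≤ n := by omega
      let wj := e ⟨j, by omega⟩
      have hRdef : ∀ i ≤ j, IsDefinedOver (IntermediateField.adjoin k (T : Set K)) (R j i) := by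
        intro i hi
        by_cases h : j < n
        · rw [hR1 j h]
          exact hdef (j + 1) le_rfl h i (by omega)
        · obtain rfl : j = n := by omega
          rw [hR2]
          refine isDefinedOver_span ?_
          rintro _ ⟨m, _, rfl⟩ c
          exact hrat _ m c
      obtain ⟨T', hTT', hT', hdef'⟩ := (hcol j hjn).exists_parameters (k := k) T
        (fun i => R j i ⊔ Submodule.span K {wj}) (fun i hi v hv => by
          have h1 : v = killCoord K j v + v ⟨j, by omega⟩ • wj := by
            funext c
            simp only [Pi.add_apply, killCoord_apply, Pi.smul_apply, smul_eq_mul, wj, e]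
            by_cases hc : (c : ℕ) = j
            · have hc' : c = ⟨j, by omega⟩ := Fin.ext hc
              rw [hc']; simp
            · have : c ≠ ⟨j, by omega⟩ := fun h => hc (congrArg Fin.val h)
              simp [hc, this]
          rw [h1]
          exact Submodule.add_mem_sup (hRle j hjn i hi ⟨v, hv, rfl⟩)
            (Submodule.smul_mem _ _ (Submodule.mem_span_singleton_self wj)))
        (fun i hi => by
          have h1 := Submodule.finrank_add_le_finrank_add_finrank (R j i) (Submodule.span K {wj})
          have h2 := finrank_span_le_card (R := K) ({wj} : Set (Fin (n + 1) → K))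
          simp only [Set.toFinset_singleton, Finset.card_singleton] at h2
          have h3 := hRfr j hjn i hi
          exact h1.trans (by omega))
        (fun i hi => (hRdef i hi).sup (isDefinedOver_span (by
          rintro _ rfl c
          exact hrat _ _ c)))
      refine ⟨T', ?_, fun j₁ h1 h2 i hi => ?_⟩
      · rw [Finset.sum_eq_sum_Ico_succ_bot (by omega)]
        omega
      · rcases Nat.eq_or_lt_of_le h1 with rfl | h
        · exact hdef' i hi
        · exact (hdef j₁ h h2 i hi).mono
            (IntermediateField.adjoin.mono k _ _ (by exact_mod_cast hTT'))
  obtain ⟨T, hcard, hdef⟩ := key (n + 1) le_rfl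
  refine ⟨T, ?_, fun j hj => ?_⟩
  · rwa [Nat.sub_self, ← Finset.range_eq_Ico] at hcard
  · rw [← (hcol j hj).top]
    exact hdef j (by omega) hj j le_rfl

end Resolution

end

/-! ### Smooth and singular points -/

section

open MvPolynomial

namespace AffineSet

variable {σ : Type} (X : Set (σ → ℂ)) (x : X)

theorem comap_ker_evalAt :
    (RingHom.ker (evalAt X x)).comap (Ideal.Quotient.mk (vanishingIdeal ℂ X)) =
      vanishingIdeal ℂ {(x : σ → ℂ)} := by
  ext f
  rw [mem_vanishingIdeal_singleton_iff]
  exact Iff.rfl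

instance isNoetherianRing_localRing [Finite σ] : IsNoetherianRing (LocalRing X x) :=
  IsLocalization.isNoetherianRing (RingHom.ker (evalAt X x)).primeCompl _
    (inferInstance : IsNoetherianRing (CoordinateRing X))

theorem ringKrullDim_localRing_le :
    ringKrullDim (LocalRing X x) ≤ ringKrullDim (CoordinateRing X) := by
  have h := IsLocalization.AtPrime.ringKrullDim_eq_height (RingHom.ker (evalAt X x)) (LocalRing X x)
  exact h.le.trans Ideal.height_le_ringKrullDim_of_isPrime

/-- The Jacobian criterion: if `X` is cut out by equations with independent gradients at `x`, then
`x` is a smooth point. -/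
theorem isSmoothPoint_of_linearIndependent [Finite σ] {E : Type} [Finite E]
    (f : E → MvPolynomial σ ℂ) (hX : X = {y | ∀ e, aeval y (f e) = 0})
    (hli : LinearIndependent ℂ fun e => gradAt (x : σ → ℂ) (f e)) : IsSmoothPoint X x := by
  have hf : ∀ e, f e ∈ vanishingIdeal ℂ X := fun e y hy => by
    rw [hX] at hy
    exact hy e
  have h1 := spanFinrank_maximalIdeal_le (R := LocalRing X x) (X := X) (RingHom.ker (evalAt X x))
    (Ideal.Quotient.mk _) Ideal.Quotient.mk_surjective Ideal.mk_ker (comap_ker_evalAt X x) x.2 f hf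
    hli
  have h2 := card_le_ringKrullDim_localRing_add (R := LocalRing X x) (X := X)
    (RingHom.ker (evalAt X x)) (Ideal.Quotient.mk _) Ideal.Quotient.mk_surjective Ideal.mk_ker
    (comap_ker_evalAt X x) f hX
  refine IsRegularLocalRing.of_spanFinrank_maximalIdeal_le _ ?_
  have h3 : (((IsLocalRing.maximalIdeal (LocalRing X x)).spanFinrank : ℕ) : WithBot ℕ∞) +
      (Nat.card E : ℕ) ≤ ringKrullDim (LocalRing X x) + (Nat.card E : ℕ) :=
    le_trans (by exact_mod_cast h1) h2
  exact ENat.WithBot.add_le_add_natCast_right_iff.mp h3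

/-- The derivative at `0` of a polynomial along a line through `0` contained in `X` vanishes if the
polynomial vanishes on `X`. -/
theorem gradAt_zero_dotProduct_eq_zero [Fintype σ] {X : Set (σ → ℂ)} {u : σ → ℂ}
    (hu : ∀ t : ℂ, t • u ∈ X) {f : MvPolynomial σ ℂ} (hf : f ∈ vanishingIdeal ℂ X) :
    gradAt 0 f ⬝ᵥ u = 0 := by
  let φ : MvPolynomial σ ℂ →ₐ[ℂ] Polynomial ℂ :=
    aeval fun s => Polynomial.C (u s) * Polynomial.X
  have hφ : ∀ (g : MvPolynomial σ ℂ) (t : ℂ), (φ g).eval t = eval (t • u) g := by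
    intro g t
    have h : (Polynomial.aeval t).comp φ = aeval (t • u) := by
      refine MvPolynomial.algHom_ext fun s => ?_
      simp only [φ, AlgHom.comp_apply, aeval_X, map_mul, Polynomial.aeval_C, Polynomial.aeval_X]
      exact mul_comm _ _
    have := DFunLike.congr_fun h g
    rwa [AlgHom.comp_apply, Polynomial.coe_aeval_eq_eval, MvPolynomial.aeval_eq_eval] at this
  have hφf : φ f = 0 := by
    refine Polynomial.funext fun t => ?_
    have := hf _ (hu t)
    rw [hφ, Polynomial.eval_zero]
    rwa [MvPolynomial.aeval_eq_eval] at this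
  have hf0 : eval (0 : σ → ℂ) f = 0 := by
    have := hφ f 0
    rw [hφf, zero_smul, Polynomial.eval_zero] at this
    exact this.symm
  have hdvd : (vanishingIdeal ℂ {(0 : σ → ℂ)}) ^ 2 ≤
      (Ideal.span {(Polynomial.X ^ 2 : Polynomial ℂ)}).comap φ := by
    rw [← Ideal.span_singleton_pow]
    refine le_trans (Ideal.pow_right_mono ?_ 2) (Ideal.le_comap_pow φ 2)
    intro g hg
    rw [mem_vanishingIdeal_singleton_iff, MvPolynomial.aeval_eq_eval] at hg
    rw [Ideal.mem_comap, Ideal.mem_span_singleton]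
    rw [Polynomial.X_dvd_iff, Polynomial.coeff_zero_eq_eval_zero]
    change (φ g).eval 0 = 0
    rw [hφ, zero_smul]
    exact hg
  have h1 := hdvd (sub_linearForm_gradAt_mem_sq (0 : σ → ℂ) f)
  rw [Ideal.mem_comap, hf0, map_zero, sub_zero, map_sub, hφf, zero_sub, Ideal.neg_mem_iff,
    Ideal.mem_span_singleton, Polynomial.X_pow_dvd_iff] at h1
  have h2 := h1 1 one_lt_two
  have h3 : φ (linearForm (0 : σ → ℂ) (gradAt 0 f)) =
      Polynomial.C (gradAt 0 f ⬝ᵥ u) * Polynomial.X := by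
    simp only [linearForm, Fintype.linearCombination_apply, map_sum, map_smul, Pi.zero_apply,
      map_zero, sub_zero, dotProduct, Finset.sum_mul]
    refine Finset.sum_congr rfl fun s _ => ?_
    simp [φ, Polynomial.smul_eq_C_mul, mul_assoc]
  rwa [h3, Polynomial.coeff_C_mul_X, if_pos rfl] at h2

/-- A point at which the gradients of the equations are dependent is singular, if the dimension
is at most the expected one and all common zeros of the gradients are tangent vectors. The last
condition is needed because the equations are not assumed to generate the ideal of `X`. -/
theorem not_isSmoothPoint_of_not_linearIndependent [Fintype σ] {E : Type} [Fintype E]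
    (f : E → MvPolynomial σ ℂ) (d : ℕ) (hd : Fintype.card σ = Fintype.card E + d)
    (hdim : ringKrullDim (LocalRing X x) ≤ d)
    (hli : ¬ LinearIndependent ℂ fun e => gradAt (x : σ → ℂ) (f e))
    (hT : ∀ v, (∀ e, gradAt (x : σ → ℂ) (f e) ⬝ᵥ v = 0) →
      ∀ g ∈ vanishingIdeal ℂ X, gradAt (x : σ → ℂ) g ⬝ᵥ v = 0) : ¬ IsSmoothPoint X x := by
  intro hreg
  have hreg : IsRegularLocalRing (LocalRing X x) := hreg
  let M : Matrix E σ ℂ := Matrix.of fun e => gradAt (x : σ → ℂ) (f e)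
  have h1 := finrank_le_spanFinrank_maximalIdeal (R := LocalRing X x) (X := X)
    (RingHom.ker (evalAt X x)) (Ideal.Quotient.mk _) Ideal.Quotient.mk_surjective Ideal.mk_ker
    (comap_ker_evalAt X x) x.2 (LinearMap.ker M.mulVecLin)
    (fun v hv => hT v fun e => congrFun (LinearMap.mem_ker.mp hv) e)
  have h2 := M.mulVecLin.finrank_range_add_finrank_ker
  rw [Module.finrank_fintype_fun_eq_card] at h2
  have h3 : Module.finrank ℂ (LinearMap.range M.mulVecLin) < Fintype.card E := by
    by_contra! h
    refine hli (linearIndependent_iff_card_le_finrank_span.mpr ?_)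
    change Fintype.card E ≤ M.rank at h
    rwa [Matrix.rank_eq_finrank_span_row] at h
  have h4 : (((IsLocalRing.maximalIdeal (LocalRing X x)).spanFinrank : ℕ) : WithBot ℕ∞) ≤ d :=
    hreg.spanFinrank_maximalIdeal.le.trans hdim
  have h5 : (IsLocalRing.maximalIdeal (LocalRing X x)).spanFinrank ≤ d := by exact_mod_cast h4
  omega

end AffineSet

end

/-! ### Gradients of the equations at a torus-fixed point -/

noncomputable section

open MvPolynomial AffineSet

namespace DegenerateFlag

variable {n : ℕ} (S : Fin n → Finset (Fin (n + 1)))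

/-- The coordinate `x_{ab}` of the `k`-th subspace, extended by zero to all indices `a` and `b`. -/
def coord {A : Type*} [CommRing A] (x : ChartIndex S → A) (k : Fin n) (a b : Fin (n + 1)) : A :=
  if h : a ∈ S k ∧ b ∉ S k then x ⟨k, ⟨a, h.1⟩, ⟨b, h.2⟩⟩ else 0

theorem entry_eq_coord {A : Type*} [CommRing A] (x : ChartIndex S → A) {k : Fin n}
    {a b : Fin (n + 1)} (hb : b ∉ S k) : entry S x k a b = coord S x k a b := by
  simp [entry, coord, hb]

theorem entry_eq_add_coord {A : Type*} [CommRing A] (x : ChartIndex S → A) (k : Fin n)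
    (a b : Fin (n + 1)) :
    entry S x k a b = (if b ∈ S k then if a = b then 1 else 0 else 0) + coord S x k a b := by
  by_cases hb : b ∈ S k <;> simp [entry, coord, hb]

variable {S}

/-- The equations in the chart of an admissible collection, separated into linear and quadratic
terms; admissibility makes the constant terms vanish. -/
theorem equation_eq (hS : IsAdmissible S) {A : Type*} [CommRing A] (x : ChartIndex S → A)
    (e : EqIndex S) :
    equation S x e =
      ((if (e.2.2 : Fin (n + 1)) = e.1.1.1.succ then 0 else coord S x e.1.1.1 e.2.1 e.2.2) -
        (if (e.2.1 : Fin (n + 1)) = e.1.1.1.succ then 0 else coord S x e.1.1.2 e.2.1 e.2.2)) -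
      ∑ b ∈ S e.1.1.2, (if b = e.1.1.1.succ then 0 else coord S x e.1.1.1 e.2.1 b) *
        coord S x e.1.1.2 b e.2.2 := by
  obtain ⟨⟨⟨k, l⟩, hkl⟩, ⟨a, ha⟩, ⟨c, hc⟩⟩ := e
  simp only at ha hc hkl
  simp only [equation]
  have h1 : (if c = k.succ then 0 else entry S x k a c) =
      if c = k.succ then 0 else coord S x k a c := by
    split_ifs with h
    · rfl
    · refine entry_eq_coord S x fun hck => ?_
      have := hS.2 k l hkl hck
      simp [hc, h] at this
  have h2 : ∑ b ∈ S l, (if b = k.succ then 0 else entry S x k a b) * entry S x l b c =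
      (if a = k.succ then 0 else coord S x l a c) +
        ∑ b ∈ S l, (if b = k.succ then 0 else coord S x k a b) * coord S x l b c := by
    have h3 : ∀ b ∈ S l, (if b = k.succ then 0 else entry S x k a b) * entry S x l b c =
        (if a = b then if a = k.succ then 0 else coord S x l a c else 0) +
          (if b = k.succ then 0 else coord S x k a b) * coord S x l b c := by
      intro b _
      rw [entry_eq_coord S x hc, entry_eq_add_coord]
      by_cases hab : a = b
      · subst hab
        by_cases h : a = k.succ
        · simp [h]
        · simp [h, ha, add_mul]
      · simp [hab]
    rw [Finset.sum_congr rfl h3, Finset.sum_add_distrib]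
    congr 1
    rw [Finset.sum_ite_eq]
    split_ifs with h h'
    · rfl
    · rfl
    · rfl
    · simp [coord, h]
  rw [h1, h2]
  ring

theorem eval_zero_coord_X (k : Fin n) (a b : Fin (n + 1)) :
    eval (0 : ChartIndex S → ℂ) (coord S X k a b) = 0 := by
  unfold coord
  split_ifs <;> simp

theorem gradAt_coord_X_dotProduct (x v : ChartIndex S → ℂ) (k : Fin n) (a b : Fin (n + 1)) :
    gradAt x (coord S X k a b) ⬝ᵥ v = coord S v k a b := by
  unfold coord
  split_ifs with h
  · rw [gradAt_X, single_dotProduct, one_mul]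
  · simp [gradAt, dotProduct]

theorem gradAt_zero_equationPoly_dotProduct (hS : IsAdmissible S) (e : EqIndex S)
    (v : ChartIndex S → ℂ) :
    gradAt 0 (equationPoly S e) ⬝ᵥ v =
      (if (e.2.2 : Fin (n + 1)) = e.1.1.1.succ then 0 else coord S v e.1.1.1 e.2.1 e.2.2) -
        (if (e.2.1 : Fin (n + 1)) = e.1.1.1.succ then 0 else coord S v e.1.1.2 e.2.1 e.2.2) := by
  have hite : ∀ (P : Prop) [Decidable P] (k : Fin n) (a b : Fin (n + 1)),
      gradAt 0 (if P then 0 else coord S X k a b) ⬝ᵥ v = if P then 0 else coord S v k a b := by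
    intro P _ k a b
    split_ifs
    · simp [gradAt, dotProduct]
    · exact gradAt_coord_X_dotProduct 0 v k a b
  have hite' : ∀ (P : Prop) [Decidable P] (k : Fin n) (a b : Fin (n + 1)),
      eval (0 : ChartIndex S → ℂ) (if P then 0 else coord S X k a b) = 0 := by
    intro P _ k a b
    split_ifs
    · simp
    · exact eval_zero_coord_X k a b
  rw [equationPoly, equation_eq hS, gradAt_sub, gradAt_sub, gradAt_sum, sub_dotProduct,
    sub_dotProduct, sum_dotProduct, Finset.sum_eq_zero, sub_zero, hite, hite]
  intro b _
  rw [gradAt_mul, add_dotProduct, smul_dotProduct, smul_dotProduct, hite', eval_zero_coord_X]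
  simp

/-- The common zeros of the gradients at the origin are tangent to the degenerate flag variety.
Their components with respect to the torus weights are again common zeros, and the line through
such a component lies in the variety, because the quadratic terms of the equations vanish on it. -/
theorem gradAt_zero_dotProduct_eq_zero_of_forall_equationPoly (hS : IsAdmissible S)
    {v : ChartIndex S → ℂ} (hv : ∀ e, gradAt 0 (equationPoly S e) ⬝ᵥ v = 0)
    {g : MvPolynomial (ChartIndex S) ℂ}
    (hg : g ∈ vanishingIdeal ℂ (chart S ⁻¹' degenerateFlagVariety n)) : gradAt 0 g ⬝ᵥ v = 0 := by
  classical
  -- The component of `v` of weight `(a, c)`.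
  let u : Fin (n + 1) × Fin (n + 1) → ChartIndex S → ℂ := fun p s =>
    if p = ((s.2.1 : Fin (n + 1)), (s.2.2 : Fin (n + 1))) then v s else 0
  have hsum : v = ∑ p, u p := by
    funext s
    rw [Finset.sum_apply, Finset.sum_ite_eq']
    simp
  have hcoord : ∀ p k a c, coord S (u p) k a c = if p = (a, c) then coord S v k a c else 0 := by
    intro p k a c
    by_cases h : a ∈ S k ∧ c ∉ S k
    · simp only [coord, dif_pos h, u]
    · simp only [coord, dif_neg h, ite_self]
  rw [hsum, dotProduct_sum]
  refine Finset.sum_eq_zero fun p _ => gradAt_zero_dotProduct_eq_zero (fun t => ?_) hg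
  rw [preimage_chart_eq S hS.1]
  intro e
  have hsmul : ∀ k a c, coord S (t • u p) k a c = t * coord S (u p) k a c := by
    intro k a c
    unfold coord
    split_ifs <;> simp
  rw [aeval_equationPoly, equation_eq hS]
  have h1 := hv e
  rw [gradAt_zero_equationPoly_dotProduct hS] at h1
  -- If `x_{ab}` and `x_{bc}` have the same weight, then `b = c`.
  have h2 : ∑ b ∈ S e.1.1.2,
      (if b = e.1.1.1.succ then 0 else coord S (t • u p) e.1.1.1 e.2.1 b) *
        coord S (t • u p) e.1.1.2 b e.2.2 = 0 := by
    refine Finset.sum_eq_zero fun b hb => ?_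
    rw [hsmul, hsmul, hcoord, hcoord]
    by_cases h3 : p = ((e.2.1 : Fin (n + 1)), b)
    · by_cases h4 : p = (b, (e.2.2 : Fin (n + 1)))
      · have h5 : b = e.2.2 := by rw [h3] at h4; exact (Prod.ext_iff.mp h4).2
        exact absurd (h5 ▸ hb) e.2.2.2
      · rw [if_neg h4]; simp
    · rw [if_neg h3]; simp
  rw [h2, sub_zero, hsmul, hsmul, hcoord, hcoord]
  by_cases h3 : p = ((e.2.1 : Fin (n + 1)), (e.2.2 : Fin (n + 1)))
  · rw [if_pos h3, if_pos h3]
    have h4 := congrArg (t * ·) h1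
    simp only [mul_sub, mul_ite, mul_zero] at h4
    exact h4
  · rw [if_neg h3, if_neg h3]; simp

/-- If `j < i` violate the condition, i.e. `i ∈ S_j` and `j + 1 ∉ S_i` in one-based notation, then
the equations of weight `(i, j + 1)` between the subspaces number `j, …, i` have gradients at the
origin that telescope to zero. -/
theorem not_linearIndependent_gradAt (hS : IsAdmissible S) {i j : Fin n} (hji : j < i)
    (hi : i.castSucc ∈ S j) (hj : j.succ ∉ S i) :
    ¬ LinearIndependent ℂ fun e => gradAt 0 (equationPoly S e) := by
  have hmem : ∀ m : ℕ, (j : ℕ) ≤ m → ∀ hm : m < n, m < i → i.castSucc ∈ S ⟨m, hm⟩ := by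
    intro m hm
    induction m, hm using Nat.le_induction with
    | base => exact fun _ _ => hi
    | succ m hjm ih =>
      intro hm hmi
      have h1 := hS.2 ⟨m, by omega⟩ ⟨m + 1, hm⟩ rfl (ih (by omega) (by omega))
      rw [Finset.mem_union, Finset.mem_singleton, Fin.ext_iff] at h1
      refine h1.resolve_right fun h => ?_
      simp only [Fin.val_castSucc, Fin.val_succ] at h
      omega
  have hnot : ∀ d m : ℕ, ∀ hm : m < n, m + d = i → (j : ℕ) < m → j.succ ∉ S ⟨m, hm⟩ := by
    intro d
    induction d with
    | zero =>
      intro m hm hmi _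
      obtain rfl : i = ⟨m, hm⟩ := Fin.ext hmi.symm
      exact hj
    | succ d ih =>
      intro m hm hmi hjm h
      have h1 := hS.2 ⟨m, hm⟩ ⟨m + 1, by omega⟩ rfl h
      rw [Finset.mem_union, Finset.mem_singleton, Fin.ext_iff] at h1
      refine ih (m + 1) (by omega) (by omega) (by omega) (h1.resolve_right fun h => ?_)
      simp only [Fin.val_succ] at h
      omega
  have hin := i.2
  let ε : Finset.Ico (j : ℕ) i → EqIndex S := fun k =>
    ⟨⟨(⟨k, by have := Finset.mem_Ico.mp k.2; omega⟩,
      ⟨k + 1, by have := Finset.mem_Ico.mp k.2; omega⟩), rfl⟩,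
      ⟨i.castSucc, hmem k (Finset.mem_Ico.mp k.2).1 _ (Finset.mem_Ico.mp k.2).2⟩,
      ⟨j.succ, hnot (i - (k + 1)) (k + 1) _ (by have := Finset.mem_Ico.mp k.2; omega)
        (by have := Finset.mem_Ico.mp k.2; omega)⟩⟩
  have hε : Function.Injective ε := by
    intro k k' h
    have h1 : (ε k).1.1.1 = (ε k').1.1.1 := by rw [h]
    exact Subtype.ext (congrArg Fin.val h1)
  intro hli
  have h1 := Fintype.linearIndependent_iff.mp (hli.comp ε hε) (fun _ => 1) ?_
    ⟨j, Finset.mem_Ico.mpr ⟨le_rfl, hji⟩⟩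
  · exact one_ne_zero h1
  · refine dotProduct_eq _ _ fun v => ?_
    rw [zero_dotProduct, sum_dotProduct]
    -- The equation number `m` has the differential `g m - g (m + 1)`; the two ends are projected
    -- away.
    let g : ℕ → ℂ := fun m => if m = j ∨ m = i then 0 else
      if hm : m < n then coord S v ⟨m, hm⟩ i.castSucc j.succ else 0
    have hterm : ∀ k : Finset.Ico (j : ℕ) i,
        ((1 : ℂ) • gradAt 0 (equationPoly S (ε k))) ⬝ᵥ v = g k - g (k + 1) := by
      rintro ⟨k, hk⟩
      have hk' := Finset.mem_Ico.mp hk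
      rw [one_smul, gradAt_zero_equationPoly_dotProduct hS]
      simp only [ε, g, Fin.ext_iff, Fin.val_succ, Fin.val_castSucc]
      congr 1
      · by_cases h : k = j
        · simp [h]
        · rw [if_neg (by omega), if_neg (by omega), dif_pos (by omega)]
      · by_cases h : k + 1 = i
        · simp [h]
        · rw [if_neg (by omega), if_neg (by omega), dif_pos (by omega)]
    have h2 : ∑ k : Finset.Ico (j : ℕ) i, (g k - g (k + 1)) = 0 := by
      rw [Finset.sum_coe_sort (Finset.Ico (j : ℕ) i) fun k => g k - g (k + 1)]
      have h3 := Finset.sum_Ico_sub g hji.le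
      have h4 : ∑ k ∈ Finset.Ico (j : ℕ) i, (g k - g (k + 1)) =
          -∑ k ∈ Finset.Ico (j : ℕ) i, (g (k + 1) - g k) := by
        rw [← Finset.sum_neg_distrib]; simp
      rw [h4, h3]
      simp [g]
    rw [← h2]
    exact Finset.sum_congr rfl fun k _ => hterm k

theorem gradAt_zero_equationPoly_apply (hS : IsAdmissible S) (e : EqIndex S) (k : Fin n)
    {a c : Fin (n + 1)} (ha : a ∈ S k) (hc : c ∉ S k) :
    gradAt 0 (equationPoly S e) ⟨k, ⟨a, ha⟩, ⟨c, hc⟩⟩ =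
      (if (e.2.2 : Fin (n + 1)) ≠ e.1.1.1.succ ∧
          e.1.1.1 = k ∧ (e.2.1 : Fin (n + 1)) = a ∧ (e.2.2 : Fin (n + 1)) = c then 1 else 0) -
        (if (e.2.1 : Fin (n + 1)) ≠ e.1.1.1.succ ∧
          e.1.1.2 = k ∧ (e.2.1 : Fin (n + 1)) = a ∧ (e.2.2 : Fin (n + 1)) = c then 1 else 0) := by
  have h := gradAt_zero_equationPoly_dotProduct hS e (Pi.single ⟨k, ⟨a, ha⟩, ⟨c, hc⟩⟩ 1)
  rw [dotProduct_single, mul_one] at h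
  rw [h]
  have hsingle : ∀ k' a' c', coord S (Pi.single ⟨k, ⟨a, ha⟩, ⟨c, hc⟩⟩ (1 : ℂ)) k' a' c' =
      if k' = k ∧ a' = a ∧ c' = c then 1 else 0 := by
    intro k' a' c'
    unfold coord
    by_cases heq : k' = k ∧ a' = a ∧ c' = c
    · obtain ⟨rfl, rfl, rfl⟩ := heq
      simp [ha, hc]
    · rw [if_neg heq]
      split_ifs with h
      · rw [Pi.single_apply, if_neg]
        intro h'
        obtain ⟨rfl, h'⟩ := Sigma.mk.inj_iff.mp h'
        have h' := Prod.ext_iff.mp (eq_of_heq h')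
        exact heq ⟨rfl, congrArg Subtype.val h'.1, congrArg Subtype.val h'.2⟩
      · rfl
  rw [hsingle, hsingle]
  congr 1 <;> split_ifs <;> tauto

theorem EqIndex.eq_of_eq {e e' : EqIndex S} (hk : e.1.1.1 = e'.1.1.1)
    (ha : (e.2.1 : Fin (n + 1)) = e'.2.1) (hc : (e.2.2 : Fin (n + 1)) = e'.2.2) : e = e' := by
  obtain ⟨⟨⟨k, l⟩, hkl⟩, ⟨a, ha⟩, ⟨c, hc⟩⟩ := e
  obtain ⟨⟨⟨k', l'⟩, hkl'⟩, ⟨a', ha'⟩, ⟨c', hc'⟩⟩ := e'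
  simp only at hk ha hc hkl hkl'
  subst hk ha hc
  obtain rfl : l = l' := Fin.ext (by omega)
  rfl

/-- If the combinatorial condition holds, then the gradients at the origin are independent: a
nontrivial relation would involve a chain of equations of one weight that ends on both sides, and
the two ends would form a pair violating the condition. -/
theorem linearIndependent_gradAt (hS : IsAdmissible S)
    (h : ∀ i j : Fin n, j < i → i.castSucc ∈ S j → j.succ ∈ S i) :
    LinearIndependent ℂ fun e => gradAt 0 (equationPoly S e) := by
  rw [Fintype.linearIndependent_iff]
  intro lam hlam
  -- A nonzero contribution to a coordinate of the relation is cancelled by another one.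
  have hother : ∀ (e : EqIndex S) (s : ChartIndex S), lam e ≠ 0 →
      gradAt 0 (equationPoly S e) s ≠ 0 →
      ∃ e' ≠ e, lam e' ≠ 0 ∧ gradAt 0 (equationPoly S e') s ≠ 0 := by
    intro e s h1 h2
    by_contra! hcon
    have h3 := congrFun hlam s
    rw [Finset.sum_apply, Finset.sum_eq_single e] at h3
    · exact (mul_ne_zero h1 h2) h3
    · intro e' _ he'
      by_cases h4 : lam e' = 0
      · simp [h4]
      · simp [hcon e' he' h4]
    · simp
  -- To the right, a chain of weight `(a, c)` can only end where the coordinate `a` is projected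
  -- away.
  have hright : ∀ (d : ℕ) (e : EqIndex S), (e.1.1.2 : ℕ) + d = n → lam e ≠ 0 →
      ∃ i : Fin n, e.1.1.2 ≤ i ∧ (e.2.1 : Fin (n + 1)) = i.castSucc ∧
        (e.2.2 : Fin (n + 1)) ∉ S i := by
    intro d
    induction d with
    | zero =>
      intro e he
      have := e.1.1.2.2
      omega
    | succ d ih =>
      intro e he hlam
      have hkl := e.1.2
      by_cases ha : (e.2.1 : Fin (n + 1)) = e.1.1.1.succ
      · refine ⟨e.1.1.2, le_rfl, ha.trans (Fin.ext ?_), e.2.2.2⟩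
        simpa using hkl
      · have hal : (e.2.1 : Fin (n + 1)) ∈ S e.1.1.2 := by
          have h1 := hS.2 _ _ hkl e.2.1.2
          rw [Finset.mem_union, Finset.mem_singleton] at h1
          exact h1.resolve_right ha
        obtain ⟨e', hne, hlam', hgrad⟩ := hother e ⟨e.1.1.2, ⟨_, hal⟩, ⟨_, e.2.2.2⟩⟩ hlam (by
          rw [gradAt_zero_equationPoly_apply hS, if_neg, if_pos]
          · simp
          · exact ⟨ha, rfl, rfl, rfl⟩
          · rintro ⟨-, h1, -⟩
            rw [h1] at hkl
            omega)
        have hkl' := e'.1.2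
        rw [gradAt_zero_equationPoly_apply hS] at hgrad
        by_cases h1 : (e'.2.2 : Fin (n + 1)) ≠ e'.1.1.1.succ ∧ e'.1.1.1 = e.1.1.2 ∧
            (e'.2.1 : Fin (n + 1)) = e.2.1 ∧ (e'.2.2 : Fin (n + 1)) = e.2.2
        · obtain ⟨-, hk, ha', hc'⟩ := h1
          have hk' := congrArg Fin.val hk
          obtain ⟨i, hi, hai, hci⟩ := ih e' (by omega) hlam'
          refine ⟨i, ?_, ha' ▸ hai, hc' ▸ hci⟩
          rw [Fin.le_def] at hi ⊢
          omega
        · rw [if_neg h1, zero_sub, neg_ne_zero, ite_ne_right_iff] at hgrad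
          obtain ⟨⟨-, hl, ha', hc'⟩, -⟩ := hgrad
          have hl' := congrArg Fin.val hl
          exact absurd (EqIndex.eq_of_eq (Fin.ext (by omega)) ha' hc') hne
  -- To the left, it can only end where the coordinate `c` is projected away.
  have hleft : ∀ (d : ℕ) (e : EqIndex S), (e.1.1.1 : ℕ) = d → lam e ≠ 0 →
      ∃ j : Fin n, j ≤ e.1.1.1 ∧ (e.2.2 : Fin (n + 1)) = j.succ ∧
        (e.2.1 : Fin (n + 1)) ∈ S j := by
    intro d
    induction d using Nat.strong_induction_on with
    | _ d ih =>
      intro e he hlam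
      have hkl := e.1.2
      by_cases hc : (e.2.2 : Fin (n + 1)) = e.1.1.1.succ
      · exact ⟨e.1.1.1, le_rfl, hc, e.2.1.2⟩
      · have hck : (e.2.2 : Fin (n + 1)) ∉ S e.1.1.1 := by
          intro h1
          have h2 := hS.2 _ _ hkl h1
          rw [Finset.mem_union, Finset.mem_singleton] at h2
          exact h2.elim e.2.2.2 hc
        obtain ⟨e', hne, hlam', hgrad⟩ := hother e ⟨e.1.1.1, ⟨_, e.2.1.2⟩, ⟨_, hck⟩⟩ hlam (by
          rw [gradAt_zero_equationPoly_apply hS, if_pos, if_neg]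
          · simp
          · rintro ⟨-, h1, -⟩
            rw [h1] at hkl
            omega
          · exact ⟨hc, rfl, rfl, rfl⟩)
        have hkl' := e'.1.2
        rw [gradAt_zero_equationPoly_apply hS] at hgrad
        by_cases h1 : (e'.2.1 : Fin (n + 1)) ≠ e'.1.1.1.succ ∧ e'.1.1.2 = e.1.1.1 ∧
            (e'.2.1 : Fin (n + 1)) = e.2.1 ∧ (e'.2.2 : Fin (n + 1)) = e.2.2
        · obtain ⟨-, hk, ha', hc'⟩ := h1
          have hk' := congrArg Fin.val hk
          obtain ⟨j, hj, hcj, haj⟩ := ih e'.1.1.1 (by omega) e' rfl hlam'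
          refine ⟨j, ?_, hc' ▸ hcj, ha' ▸ haj⟩
          rw [Fin.le_def] at hj ⊢
          omega
        · rw [if_neg h1, sub_zero, ite_ne_right_iff] at hgrad
          obtain ⟨⟨-, hk, ha', hc'⟩, -⟩ := hgrad
          exact absurd (EqIndex.eq_of_eq hk ha' hc') hne
  intro e
  by_contra hne
  have hl := e.1.1.2.2
  have hkl := e.1.2
  obtain ⟨i, hi, hai, hci⟩ := hright (n - e.1.1.2) e (by omega) hne
  obtain ⟨j, hj, hcj, haj⟩ := hleft _ e rfl hne
  rw [hai] at haj
  rw [hcj] at hci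
  refine hci (h i j ?_ haj)
  rw [Fin.le_def] at hi hj
  rw [Fin.lt_def]
  omega

/-! ### The dimension of the degenerate flag variety -/

/-- The number of coordinates of a chart exceeds the number of equations by `0 + 1 + ⋯ + n`. -/
theorem card_chartIndex (hS : IsCollection S) :
    Fintype.card (ChartIndex S) =
      Fintype.card (EqIndex S) + ∑ j ∈ Finset.range (n + 1), j := by
  have h1 : Fintype.card (ChartIndex S) = ∑ k : Fin n, ((k : ℕ) + 1) * (n - k) := by
    rw [Fintype.card_sigma]
    refine Finset.sum_congr rfl fun k _ => ?_
    rw [Fintype.card_prod, Fintype.card_coe, hS k, Fintype.card_subtype_compl, Fintype.card_fin,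
      Fintype.card_coe, hS k]
    congr 1
    omega
  have h2 : Fintype.card (EqIndex S) = ∑ l : Fin n, (l : ℕ) * (n - l) := by
    rw [Fintype.card_sigma]
    refine Fintype.sum_of_injective (fun p => p.1.2) ?_ _ _ ?_ ?_
    · rintro ⟨⟨k, l⟩, hkl⟩ ⟨⟨k', l'⟩, hkl'⟩ h
      simp only at h hkl hkl'
      subst h
      obtain rfl : k = k' := Fin.ext (by omega)
      rfl
    · intro l hl
      have : (l : ℕ) = 0 := by
        by_contra h0
        exact hl ⟨⟨(⟨l - 1, by omega⟩, l), by simp only; omega⟩, rfl⟩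
      simp [this]
    · rintro ⟨⟨k, l⟩, hkl⟩
      simp only at hkl ⊢
      rw [Fintype.card_prod, Fintype.card_coe, hS k, Fintype.card_subtype_compl, Fintype.card_fin,
        Fintype.card_coe, hS l, hkl]
      congr 1
      omega
  have h3 : ∑ j ∈ Finset.range (n + 1), j = ∑ k : Fin n, (n - (k : ℕ)) := by
    rw [← Finset.sum_range_reflect, Finset.sum_range_succ,
      Fin.sum_univ_eq_sum_range (fun k => n - k)]
    simp
  rw [h1, h2, h3, ← Finset.sum_add_distrib]
  exact Finset.sum_congr rfl fun k _ => by ring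

/-- The degenerate flag variety has dimension at most `n(n + 1)/2` in each chart, because this is
the number of parameters of a degenerate flag over any extension field of `ℂ`. -/
theorem ringKrullDim_coordinateRing_le (hS : IsCollection S) :
    ringKrullDim (CoordinateRing (chart S ⁻¹' degenerateFlagVariety n)) ≤
      (∑ j ∈ Finset.range (n + 1), j : ℕ) := by
  refine ringKrullDim_quotient_le_of_forall_point _ _ fun K _ _ x hx => ?_
  have heq : ∀ e, equation S x e = 0 := by
    intro e
    rw [← aeval_equationPoly]
    refine hx _ fun y hy => ?_
    rw [preimage_chart_eq S hS] at hy
    exact hy e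
  -- The flag given by the point `x`, numbered from one, with the zero space put in front.
  let U : ℕ → Submodule K (Fin (n + 1) → K) := fun j =>
    if h : 0 < j ∧ j ≤ n then rowSpan S x ⟨j - 1, by omega⟩ else ⊥
  have hU : ∀ k : Fin n, U (k + 1) = rowSpan S x k := by
    intro k
    have hk : 0 < (k : ℕ) + 1 ∧ (k : ℕ) + 1 ≤ n := by omega
    simp only [U, dif_pos hk]
    rfl
  have hU0 : U 0 = ⊥ := dif_neg (by omega)
  obtain ⟨T, hT, hdef⟩ := exists_parameters_of_degenerateFlag (k := ℂ) (n := n) (U := U) (by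
    rintro (_ | j) hj
    · rw [hU0]; exact finrank_bot _ _
    · rw [hU ⟨j, hj⟩]
      exact (finrank_span_rows (entry_eq_ite S x ⟨j, hj⟩)).trans (hS ⟨j, hj⟩)) (by
    rintro (_ | j) hj
    · rw [hU0, Submodule.map_bot]; exact bot_le
    · rw [hU ⟨j, by omega⟩, hU ⟨j + 1, hj⟩]
      exact (map_killCoord_rowSpan_le_iff S x ⟨j, by omega⟩ ⟨j + 1, hj⟩ rfl).mpr fun a c => heq _)
  refine ⟨T, hT, ?_⟩
  rintro ⟨k, ⟨a, ha⟩, ⟨b, hb⟩⟩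
  have h1 := hdef (k + 1) (by omega)
  rw [hU k] at h1
  have h2 := h1.row_mem (entry_eq_ite S x k) ha b
  simpa [entry, ha, hb] using h2

end DegenerateFlag

end

/-! ### The smoothness criterion -/

/-- With the index shift `k : Fin n ↔ k + 1`, the condition reads: for all `1 ≤ j < i ≤ n`,
`i ∈ S_j` implies `j + 1 ∈ S_i`. -/
theorem mainTheorem1 (n : ℕ) (S : Fin n → Finset (Fin (n + 1)))
    (hS : DegenerateFlag.IsAdmissible S) :
    DegenerateFlag.IsSmoothPoint (DegenerateFlag.degenerateFlagVariety n)
        (DegenerateFlag.fixedPoint S) ↔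
      ∀ i j : Fin n, j < i → i.castSucc ∈ S j → j.succ ∈ S i := by
  have hX := DegenerateFlag.preimage_chart_eq S hS.1
  constructor
  · rintro ⟨J, hJ, ⟨x, hx⟩, hxp, hsmooth⟩ i j hji hi
    obtain rfl := DegenerateFlag.chart_eq_fixedPoint S hJ hS.1 hxp
    obtain rfl := (DegenerateFlag.chart_eq_fixedPoint_iff J).mp hxp
    by_contra hj
    have hdim := (AffineSet.ringKrullDim_localRing_le _ ⟨0, hx⟩).trans
      (DegenerateFlag.ringKrullDim_coordinateRing_le hS.1)
    have hli := DegenerateFlag.not_linearIndependent_gradAt hS hji hi hj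
    have hcard := DegenerateFlag.card_chartIndex hS.1
    generalize ∑ m ∈ Finset.range (n + 1), m = d at hdim hcard
    exact AffineSet.not_isSmoothPoint_of_not_linearIndependent _ ⟨0, hx⟩
      (DegenerateFlag.equationPoly J) d hcard hdim hli
      (fun v hv g hg =>
        DegenerateFlag.gradAt_zero_dotProduct_eq_zero_of_forall_equationPoly hS hv hg) hsmooth
  · intro h
    have h0 : (0 : DegenerateFlag.ChartIndex S → ℂ) ∈
        DegenerateFlag.chart S ⁻¹' DegenerateFlag.degenerateFlagVariety n := by
      rw [hX]
      intro e
      rw [DegenerateFlag.aeval_equationPoly, DegenerateFlag.equation_eq hS]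
      simp [DegenerateFlag.coord]
    exact ⟨S, hS.1, ⟨0, h0⟩, DegenerateFlag.chart_zero S,
      AffineSet.isSmoothPoint_of_linearIndependent _ _ (DegenerateFlag.equationPoly S) hX
        (DegenerateFlag.linearIndependent_gradAt hS h)⟩
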